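/- \textbf{Setting.} Let $\Theta\subset\mathbb{R}^d$ be compact and convex, let $\mathcal{X}\subset\mathbb{R}^q$ be a finite set of contexts with $\|x-y\|_2\le B$ for all $x,y\in\mathcal{X}$ and some finite $B>0$, let $\hat P$ be a probability distribution on $\mathcal{X}$, and let $a_1,\dots,a_k$ be actions. For $\theta\in\Theta$ and $\zeta\in\mathcal{X}$ let $\pi_\theta(\cdot\mid\zeta)$ be a probability distribution on the actions, let $\hat m(\zeta,a_i)\in\mathbb{R}$ be given cost estimates, and put $\hat l(\theta,\zeta)=\sum_{i=1}^k\pi_\theta(a_i\mid\zeta)\,\hat m(\zeta,a_i)$. (The policy is given on a neighbourhood of $\Theta$, so that gradients of $\hat l$ in $\theta$ make sense on all of $\Theta$.) For $\eta>0$ and $\epsilon_x>0$ consider the problem of minimizing over $\Theta\times[0,\infty)$ the function $$F(\theta,\lambda)=\mathbb{E}_{x\sim\hat P}\Big[\frac1\eta\log\Big(\sum_{\zeta\in\mathcal{X}}\frac{1}{|\mathcal{X}|}e^{\eta(\hat l(\theta,\zeta)-\lambda\|x-\zeta\|_2^2)}\Big)\Big]+\epsilon_x\lambda .$$ \textbf{Algorithm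 (biased SGD).} Start at $\theta_0\in\Theta$, $\lambda_0\ge 0$. For $t=0,\dots,T-1$: sample $x_t\sim\hat P$ and, independently, $m_t$ i.i.d. points $\zeta_1,\dots,\zeta_{m_t}$ uniformly from $\mathcal{X}$ (all samples being independent of the past); with $g_j=e^{\eta(\hat l(\theta_t,\zeta_j)-\lambda_t\|x_t-\zeta_j\|_2^2)}$ set $$v_t=\frac{\sum_j g_j\nabla_\theta\hat l(\theta_t,\zeta_j)}{\sum_j g_j},\qquad w_t=-\frac{\sum_j g_j\|x_t-\zeta_j\|_2^2}{\sum_j g_j}+\epsilon_x,$$ $$\theta_{t+1}=\Pi_\Theta(\theta_t-\gamma_t v_t),\qquad \lambda_{t+1}=\max\{\lambda_t-\gamma_t w_t,\,0\},$$ where $\Pi_\Theta$ is the Euclidean projection onto $\Theta$. The output $\hat u$ is chosen uniformly at random from $(\theta_0,\lambda_0),\dots,(\theta_{T-1},\lambda_{T-1})$. The total number of queries (evaluations of $\hat l(\cdot,\zeta)$ and its gradient at a sampled point) is $\sum_{t<T}m_t$. \textbf{Theorem.} Suppose that for every $\zeta\in\mathcal{X}$ the function $\hat l(\cdot,\zeta)$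 is $L$-smooth on $\Theta$, that is, differentiable at every point of $\Theta$ with a gradient that is $L$-Lipschitz on $\Theta$. Fix $c>0$ and $\delta_0>0$ and run the algorithm with step sizes $\gamma_t=c\,T^{-1/2}$. (i) If moreover $\hat l(\cdot,\zeta)$ is convex on $\Theta$ for every $\zeta\in\mathcal{X}$, then there are constants $C_m,C_T,C_Q>0$, independent of $\delta$, such that for every $0<\delta\le\delta_0$: whenever $T\ge C_T\delta^{-2}$ and $m_t\ge C_m\delta^{-1}$ for all $t<T$, the output is $\delta$-accurate in expectation, i.e. $$\mathbb{E}[F(\hat u)]-\inf_{\Theta\times[0,\infty)}F\le\delta .$$ In particular $T=\lceil C_T\delta^{-2}\rceil=\mathcal{O}(\delta^{-2})$ iterations with $m_t=\lceil C_m\delta^{-1}\rceil=\mathcal{O}(\delta^{-1})$ suffice, and the total number of queries is then at most $C_Q\delta^{-3}$. (ii) Without convexity of $\hat l$: for every $r>0$ there are constants $C_m,C_T,C_Q>0$, independent of $\delta$, such that for every $0<\delta\le\delta_0$: whenever $T\ge C_T\delta^{-4}$ and $m_t\ge C_m\delta^{-2}$ for all $t<T$, the output is a $\delta$-stationary point in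 expectation, i.e. $$\mathbb{E}\big[\|G_r(\hat u)\|_2^2\big]\le\delta^2,\qquad G_r(u)=\frac1r\Big(u-\Pi_{\Theta\times[0,\infty)}\big(u-r\nabla F(u)\big)\Big),$$ where $G_r$ is the gradient mapping of $F$ (a point of $\Theta\times[0,\infty)$ is a stationary point of the constrained problem exactly when $G_r$ vanishes there). In particular $T=\lceil C_T\delta^{-4}\rceil=\mathcal{O}(\delta^{-4})$ iterations with $m_t=\lceil C_m\delta^{-2}\rceil=\mathcal{O}(\delta^{-2})$ suffice, and the total number of queries is then at most $C_Q\delta^{-6}$. -/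

import Mathlib

noncomputable section

namespace WassersteinOPL

/-- The data of the regularized Wasserstein off-policy learning problem: policy parameters in
`ℝ^d`, contexts in `ℝ^q`, and `k` actions. The policy is a function on the ambient parameter space,
so that gradients in the parameter make sense at the boundary of `Θ`; only its values near `Θ`
matter. -/
structure Problem (d q k : ℕ) where
  /-- the policy parameter space -/
  Θ : Set (EuclideanSpace ℝ (Fin d))
  /-- the (finite) context support set -/
  𝒳 : Finset (EuclideanSpace ℝ (Fin q))
  /-- the nominal distribution of the contexts -/
  ctx : PMF 𝒳
  /-- `pol θ ζ a` is the probability of the action `a` in the context `ζ` -/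
  pol : EuclideanSpace ℝ (Fin d) → 𝒳 → Fin k → ℝ
  /-- the robust cost estimates -/
  mhat : 𝒳 → Fin k → ℝ
  /-- the context uncertainty radius -/
  εx : ℝ
  /-- the smoothing parameter -/
  η : ℝ

/-- The Euclidean projection onto `K`: a point of `K` nearest to `x` (it exists and is unique when
`K` is nonempty, closed and convex). -/
def proj {d : ℕ} (K : Set (EuclideanSpace ℝ (Fin d))) (x : EuclideanSpace ℝ (Fin d)) :
    EuclideanSpace ℝ (Fin d) :=
  Classical.epsilon fun y => y ∈ K ∧ ∀ z ∈ K, dist x y ≤ dist x z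

/-- `f` is `L`-smooth on `S`: differentiable at every point of `S`, with an `L`-Lipschitz
gradient. -/
def SmoothOn {d : ℕ} (L : ℝ) (f : EuclideanSpace ℝ (Fin d) → ℝ)
    (S : Set (EuclideanSpace ℝ (Fin d))) : Prop :=
  (∀ x ∈ S, DifferentiableAt ℝ f x) ∧
    ∀ x ∈ S, ∀ y ∈ S, ‖gradient f x - gradient f y‖ ≤ L * ‖x - y‖

/-- The expectation of `f` under the discrete distribution `p`. It is only used for distributions
of finite support. -/
def expect {α : Type*} (p : PMF α) (f : α → ℝ) : ℝ := ∑' a, (p a).toReal * f a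

namespace Problem

variable {d q k : ℕ} (P : Problem d q k)

/-- The expected robust cost `l̂(θ, ζ) = ∑ₐ π_θ(a | ζ) m̂(ζ, a)`. -/
def lhat (θ : EuclideanSpace ℝ (Fin d)) (ζ : P.𝒳) : ℝ :=
  ∑ a, P.pol θ ζ a * P.mhat ζ a

/-- The weight `g(ζ; θ, λ) = exp (η (l̂(θ, ζ) - λ ‖x - ζ‖²))` for the sampled context `x`. -/
def g (x ζ : P.𝒳) (θ : EuclideanSpace ℝ (Fin d)) (lam : ℝ) : ℝ :=
  Real.exp (P.η * (P.lhat θ ζ - lam * ‖(x : EuclideanSpace ℝ (Fin q)) - ζ‖ ^ 2))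

/-- The regularized objective
`E_{x ∼ P̂} [(1/η) log (∑_ζ (1/|𝒳|) exp (η (l̂(θ, ζ) - λ ‖x - ζ‖²)))] + ε_x λ`. -/
def objective (θ : EuclideanSpace ℝ (Fin d)) (lam : ℝ) : ℝ :=
  ∑ x : P.𝒳, (P.ctx x).toReal *
      (1 / P.η * Real.log (∑ ζ : P.𝒳, 1 / (P.𝒳.card : ℝ) * P.g x ζ θ lam))
    + P.εx * lam

/-- The stochastic gradient in the policy parameter, for the context `x` and the batch `ζ`. -/
def gradθ {m : ℕ} (x : P.𝒳) (ζ : Fin m → P.𝒳) (θ : EuclideanSpace ℝ (Fin d)) (lam : ℝ) :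
    EuclideanSpace ℝ (Fin d) :=
  (∑ j, P.g x (ζ j) θ lam)⁻¹ •
    ∑ j, P.g x (ζ j) θ lam • gradient (fun θ' => P.lhat θ' (ζ j)) θ

/-- The stochastic derivative in the dual variable, for the context `x` and the batch `ζ`. -/
def gradlam {m : ℕ} (x : P.𝒳) (ζ : Fin m → P.𝒳) (θ : EuclideanSpace ℝ (Fin d)) (lam : ℝ) : ℝ :=
  -((∑ j, P.g x (ζ j) θ lam * ‖(x : EuclideanSpace ℝ (Fin q)) - ζ j‖ ^ 2) /
      ∑ j, P.g x (ζ j) θ lam) + P.εx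

/-- The update of the iterate `u = (θ, λ)` with step size `γ`, for the context `x` and the
batch `ζ`. -/
def update {m : ℕ} (γ : ℝ) (u : EuclideanSpace ℝ (Fin d) × ℝ) (x : P.𝒳) (ζ : Fin m → P.𝒳) :
    EuclideanSpace ℝ (Fin d) × ℝ :=
  (proj P.Θ (u.1 - γ • P.gradθ x ζ u.1 u.2), max (u.2 - γ * P.gradlam x ζ u.1 u.2) 0)

/-- One randomized iteration from the iterate `u`: sample a context `x` from the nominal
distribution, sample `m` independent uniform points of `𝒳` (that is, a uniform element of
`Fin m → 𝒳`), and update. -/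
def step (γ : ℝ) (m : ℕ) (u : EuclideanSpace ℝ (Fin d) × ℝ) :
    PMF (EuclideanSpace ℝ (Fin d) × ℝ) :=
  P.ctx.bind fun x =>
    haveI : Nonempty P.𝒳 := ⟨x⟩
    (PMF.uniformOfFintype (Fin m → P.𝒳)).map fun ζ => P.update γ u x ζ

/-- The law of the iterate `u_t = (θ_t, λ_t)` of the biased stochastic gradient descent, with step
sizes `γ_t`, batch sizes `m_t` and starting point `u₀ = (θ₀, λ₀)`. -/
def iterate (γ : ℕ → ℝ) (m : ℕ → ℕ) (u₀ : EuclideanSpace ℝ (Fin d) × ℝ) :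
    ℕ → PMF (EuclideanSpace ℝ (Fin d) × ℝ)
  | 0 => PMF.pure u₀
  | t + 1 => (iterate γ m u₀ t).bind (P.step (γ t) (m t))

/-- The law of the output of a run with `T` iterations: an iterate chosen uniformly at random
from `u_0, …, u_{T-1}`. -/
def output (T : ℕ) [NeZero T] (γ : ℕ → ℝ) (m : ℕ → ℕ) (u₀ : EuclideanSpace ℝ (Fin d) × ℝ) :
    PMF (EuclideanSpace ℝ (Fin d) × ℝ) :=
  (PMF.uniformOfFintype (Fin T)).bind fun t => P.iterate γ m u₀ t

/-- The squared Euclidean norm of the gradient mapping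
`(u - Π (u - r ∇F(u))) / r` of the objective `F` at `u = (θ, λ)`, where `Π` is the projection onto
`Θ × [0, ∞)`; that projection acts on each component. -/
def gradMapSq (r : ℝ) (u : EuclideanSpace ℝ (Fin d) × ℝ) : ℝ :=
  ‖r⁻¹ • (u.1 - proj P.Θ (u.1 - r • gradient (fun θ => P.objective θ u.2) u.1))‖ ^ 2 +
    (r⁻¹ * (u.2 - max (u.2 - r * deriv (fun lam => P.objective u.1 lam) u.2) 0)) ^ 2

end Problem

/-- The number of queries (evaluations of `l̂(·, ζ)` and its gradient at a sampled point) in a run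
of `T` iterations with batch sizes `m_t`. -/
def totalQueries (T : ℕ) (m : ℕ → ℕ) : ℕ := ∑ t ∈ Finset.range T, m t

namespace Problem

variable {d q k : ℕ} (P : Problem d q k)

theorem finite_support_step (γ : ℝ) (m : ℕ) (u : EuclideanSpace ℝ (Fin d) × ℝ) :
    (P.step γ m u).support.Finite := by
  unfold step
  rw [PMF.support_bind]
  refine Set.Finite.biUnion (Set.toFinite _) fun x _ => ?_
  rw [PMF.support_map]
  exact (Set.toFinite _).image _

theorem finite_support_iterate (γ : ℕ → ℝ) (m : ℕ → ℕ) (u₀ : EuclideanSpace ℝ (Fin d) × ℝ)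
    (t : ℕ) : (P.iterate γ m u₀ t).support.Finite := by
  induction t with
  | zero => rw [iterate, PMF.support_pure]; exact Set.finite_singleton _
  | succ t ih =>
    rw [iterate, PMF.support_bind]
    exact Set.Finite.biUnion ih fun u _ => P.finite_support_step _ _ u

/-- The output takes finitely many values, so that its expectations are finite sums. -/
theorem finite_support_output (T : ℕ) [NeZero T] (γ : ℕ → ℝ) (m : ℕ → ℕ)
    (u₀ : EuclideanSpace ℝ (Fin d) × ℝ) : (P.output T γ m u₀).support.Finite := by
  rw [output, PMF.support_bind]
  exact Set.Finite.biUnion (Set.toFinite _) fun t _ => P.finite_support_iterate _ _ _ _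

end Problem

end WassersteinOPL

end

/-!
The ratio of two batch means is a biased estimate of the ratio of their expectations, but the error
is of second order in the fluctuations of the two means, so a batch of size `m` gives the gradient
of the objective up to a bias of order `1 / m`, uniformly over the feasible set. The term `ζ = x` of
the inner sum does not decay in `λ`, so the objective grows at least linearly in `λ`. Hence it has a
minimizer `z`, and the distance from `u` to `z` is at most affine in the optimality gap of `u`.

In the convex case `‖u - z‖²` decreases in expectation by the step size times the gap, up to the
effect of the bias, a multiple of `‖u - z‖ / m` that the gap absorbs for large `m`. In general the
objective is weakly convex, and the same computation, with `z` replaced by the proximal point `y` of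
`u`, shows that the Moreau envelope decreases by a multiple of `‖y - u‖²`. As the gradient of the
objective is Lipschitz, `‖y - u‖` controls the gradient mapping. Here the bias enters squared.
-/

noncomputable section

namespace WassersteinOPL

open scoped BigOperators RealInnerProductSpace

section Expectation

variable {α β : Type*} {p : PMF α} {f f' : α → ℝ}

theorem expect_eq_sum {s : Finset α} (hs : p.support ⊆ s) (f : α → ℝ) :
    expect p f = ∑ a ∈ s, (p a).toReal * f a :=
  tsum_eq_sum fun a ha => by simp [(p.apply_eq_zero_iff a).2 fun h => ha (hs h)]

theorem expect_fintype [Fintype α] (p : PMF α) (f : α → ℝ) :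
    expect p f = ∑ a, (p a).toReal * f a :=
  tsum_fintype _

theorem sum_toReal_eq_one {s : Finset α} (hs : p.support ⊆ s) : ∑ a ∈ s, (p a).toReal = 1 := by
  have hsum : ∑ a ∈ s, p a = 1 := by
    rw [← p.tsum_coe]
    exact (tsum_eq_sum fun a ha => (p.apply_eq_zero_iff a).2 fun h => ha (hs h)).symm
  rw [← ENNReal.toReal_sum fun a _ => p.apply_ne_top a, hsum, ENNReal.toReal_one]

theorem toReal_bind_apply {s : Finset α} (hs : p.support ⊆ s) (q : α → PMF β) (b : β) :
    ((p.bind q) b).toReal = ∑ a ∈ s, (p a).toReal * (q a b).toReal := by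
  rw [PMF.bind_apply, tsum_eq_sum (s := s) fun a ha => by
      simp [(p.apply_eq_zero_iff a).2 fun h => ha (hs h)],
    ENNReal.toReal_sum fun a _ => ENNReal.mul_ne_top (p.apply_ne_top a) ((q a).apply_ne_top b)]
  simp only [ENNReal.toReal_mul]

theorem expect_bind {q : α → PMF β} (hp : p.support.Finite)
    (hq : ∀ a ∈ p.support, (q a).support.Finite) (f : β → ℝ) :
    expect (p.bind q) f = expect p fun a => expect (q a) f := by
  have hU : (⋃ a ∈ p.support, (q a).support).Finite := hp.biUnion hq
  have hps : p.support ⊆ hp.toFinset := hp.coe_toFinset.ge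
  have hbind : (p.bind q).support ⊆ hU.toFinset := by
    rw [PMF.support_bind, Set.Finite.coe_toFinset]
  have hqa : ∀ a ∈ hp.toFinset, (q a).support ⊆ hU.toFinset := fun a ha => by
    rw [Set.Finite.coe_toFinset]
    exact Set.subset_biUnion_of_mem (u := fun a => (q a).support) (hp.mem_toFinset.1 ha)
  rw [expect_eq_sum hbind, expect_eq_sum hps]
  simp only [toReal_bind_apply hps, Finset.sum_mul]
  rw [Finset.sum_comm]
  refine Finset.sum_congr rfl fun a ha => ?_
  rw [expect_eq_sum (hqa a ha), Finset.mul_sum]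
  simp only [mul_assoc]

theorem expect_pure (a : α) (f : α → ℝ) : expect (PMF.pure a) f = f a := by
  rw [expect_eq_sum (s := {a}) (by simp)]
  simp

theorem expect_map (hp : p.support.Finite) (e : α → β) (f : β → ℝ) :
    expect (p.map e) f = expect p fun a => f (e a) := by
  rw [PMF.map, expect_bind hp fun a _ => by simp [PMF.support_pure]]
  simp only [Function.comp_apply, expect_pure]

theorem expect_uniformOfFintype [Fintype α] [Nonempty α] (f : α → ℝ) :
    expect (PMF.uniformOfFintype α) f = 𝔼 a, f a := by
  rw [expect_fintype, Fintype.expect_eq_sum_div_card, div_eq_inv_mul, Finset.mul_sum]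
  simp only [PMF.uniformOfFintype_apply, ENNReal.toReal_inv, ENNReal.toReal_natCast]

theorem expect_mono (hp : p.support.Finite) (h : ∀ a ∈ p.support, f a ≤ f' a) :
    expect p f ≤ expect p f' := by
  have hps : p.support ⊆ hp.toFinset := hp.coe_toFinset.ge
  rw [expect_eq_sum hps, expect_eq_sum hps]
  gcongr with a ha
  exact h a (hp.mem_toFinset.1 ha)

theorem expect_add (hp : p.support.Finite) (f f' : α → ℝ) :
    expect p (fun a => f a + f' a) = expect p f + expect p f' := by
  have hps : p.support ⊆ hp.toFinset := hp.coe_toFinset.ge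
  simp only [expect_eq_sum hps, mul_add, Finset.sum_add_distrib]

theorem expect_const_mul (p : PMF α) (c : ℝ) (f : α → ℝ) :
    expect p (fun a => c * f a) = c * expect p f := by
  simp only [expect, ← tsum_mul_left, mul_left_comm c]

theorem expect_const (hp : p.support.Finite) (c : ℝ) : expect p (fun _ => c) = c := by
  have hps : p.support ⊆ hp.toFinset := hp.coe_toFinset.ge
  rw [expect_eq_sum hps, ← Finset.sum_mul, sum_toReal_eq_one hps, one_mul]

theorem const_le_expect (hp : p.support.Finite) {c : ℝ} (h : ∀ a ∈ p.support, c ≤ f a) :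
    c ≤ expect p f :=
  (expect_const hp c).symm.trans_le (expect_mono hp h)

end Expectation

section CenterMass

variable {ι : Type*} [Fintype ι]

theorem map_centerMass {R E F Φ : Type*} [Field R] [AddCommGroup E] [Module R E] [AddCommGroup F]
    [Module R F] [FunLike Φ E F] [LinearMapClass Φ R E F] (φ : Φ) (w : ι → R) (s : ι → E) :
    φ (Finset.univ.centerMass w s) = Finset.univ.centerMass w fun i => φ (s i) := by
  simp only [Finset.centerMass, map_smul, map_sum]

theorem norm_centerMass_le [Nonempty ι] {E : Type*} [SeminormedAddCommGroup E] [NormedSpace ℝ E]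
    {w : ι → ℝ} (hw : ∀ i, 0 < w i) {s : ι → E} {G : ℝ} (hs : ∀ i, ‖s i‖ ≤ G) :
    ‖Finset.univ.centerMass w s‖ ≤ G := by
  have hmem := (convex_closedBall (0 : E) G).centerMass_mem (t := Finset.univ) (z := s)
    (fun i _ => (hw i).le) (Finset.sum_pos (fun i _ => hw i) Finset.univ_nonempty)
    fun i _ => mem_closedBall_zero_iff.2 (hs i)
  exact mem_closedBall_zero_iff.1 hmem

end CenterMass

section Batch

variable {X : Type*} [Fintype X]

theorem expect_batch_succ (m : ℕ) (f : (Fin (m + 1) → X) → ℝ) :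
    𝔼 ω, f ω = 𝔼 x, 𝔼 ω : Fin m → X, f (Fin.cons x ω) := by
  rw [← Finset.expect_product', Finset.univ_product_univ]
  exact (Fintype.expect_equiv (Fin.consEquiv fun _ => X) _ _ fun _ => rfl).symm

variable [Nonempty X]

theorem expect_batch_sum_eq_zero {c : X → ℝ} (hc : 𝔼 x, c x = 0) (m : ℕ) :
    𝔼 ω : Fin m → X, ∑ j, c (ω j) = 0 := by
  induction m with
  | zero => simp
  | succ m ih =>
    simp only [expect_batch_succ, Fin.sum_univ_succ, Fin.cons_zero, Fin.cons_succ,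
      Finset.expect_add_distrib, ih, Fintype.expect_const, hc, add_zero]

theorem expect_batch_sum_sq {c : X → ℝ} (hc : 𝔼 x, c x = 0) (m : ℕ) :
    𝔼 ω : Fin m → X, (∑ j, c (ω j)) ^ 2 = m * 𝔼 x, c x ^ 2 := by
  induction m with
  | zero => simp
  | succ m ih =>
    simp only [expect_batch_succ, Fin.sum_univ_succ, Fin.cons_zero, Fin.cons_succ, add_sq,
      Finset.expect_add_distrib, ← Finset.mul_expect, expect_batch_sum_eq_zero hc, ih,
      Fintype.expect_const, mul_zero, add_zero]
    push_cast
    ring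

theorem expect_batch_mean_eq_zero {c : X → ℝ} (hc : 𝔼 x, c x = 0) (m : ℕ) :
    𝔼 ω : Fin m → X, 𝔼 j, c (ω j) = 0 := by
  simp only [Fintype.expect_eq_sum_div_card (ι := Fin m), ← Finset.expect_div,
    expect_batch_sum_eq_zero hc, zero_div]

theorem expect_batch_mean_sq {c : X → ℝ} (hc : 𝔼 x, c x = 0) (m : ℕ) :
    𝔼 ω : Fin m → X, (𝔼 j, c (ω j)) ^ 2 = (𝔼 x, c x ^ 2) / m := by
  simp only [Fintype.expect_eq_sum_div_card (ι := Fin m), div_pow, ← Finset.expect_div,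
    expect_batch_sum_sq hc, Fintype.card_fin]
  rcases eq_or_ne (m : ℝ) 0 with hm | hm
  · simp [hm]
  · field_simp

theorem expect_sq_le_card {w : X → ℝ} (hw : ∀ x, 0 ≤ w x) (hw1 : 𝔼 x, w x = 1) :
    𝔼 x, w x ^ 2 ≤ Fintype.card X := by
  have hsum : ∑ x, w x = Fintype.card X := by
    rwa [Fintype.expect_eq_sum_div_card,
      div_eq_one_iff_eq (by exact_mod_cast Fintype.card_ne_zero)] at hw1
  calc 𝔼 x, w x ^ 2 ≤ 𝔼 x, (Fintype.card X : ℝ) * w x := by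
        refine Finset.expect_le_expect fun x _ => ?_
        rw [sq, ← hsum]
        exact mul_le_mul_of_nonneg_right
          (Finset.single_le_sum (fun y _ => hw y) (Finset.mem_univ x)) (hw x)
    _ = Fintype.card X := by rw [← Finset.mul_expect, hw1, mul_one]

theorem expect_sub_one_sq_le_card {w : X → ℝ} (hw : ∀ x, 0 ≤ w x) (hw1 : 𝔼 x, w x = 1) :
    𝔼 x, (w x - 1) ^ 2 ≤ (Fintype.card X : ℝ) := by
  have hw2 := expect_sq_le_card hw hw1
  simp only [sub_sq, mul_one, one_pow, Finset.expect_add_distrib, Finset.expect_sub_distrib,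
    ← Finset.mul_expect, hw1, Fintype.expect_const]
  linarith

theorem expect_mul_sq_le_card {w f : X → ℝ} (hw : ∀ x, 0 ≤ w x) (hw1 : 𝔼 x, w x = 1) {R : ℝ}
    (hf : ∀ x, |f x| ≤ R) : 𝔼 x, (w x * f x) ^ 2 ≤ R ^ 2 * Fintype.card X := by
  calc 𝔼 x, (w x * f x) ^ 2 ≤ 𝔼 x, R ^ 2 * w x ^ 2 := by
        refine Finset.expect_le_expect fun x _ => ?_
        rw [mul_pow, mul_comm]
        exact mul_le_mul_of_nonneg_right (sq_le_sq.2 ((hf x).trans (le_abs_self R)))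
          (sq_nonneg _)
    _ ≤ R ^ 2 * Fintype.card X := by
        rw [← Finset.mul_expect]
        gcongr
        exact expect_sq_le_card hw hw1

-- With `ρ = N / (1 + A)`, replacing the denominator by `1` costs only second-order terms.
theorem abs_sub_le_of_mul_one_add_eq {ρ N A R : ℝ} (h : ρ * (1 + A) = N) (hρ : |ρ| ≤ R) :
    |ρ - N| ≤ |N| * |A| + R * A ^ 2 := by
  have hexpand : ρ - N = -(N * A) + ρ * A ^ 2 := by rw [← h]; ring
  calc |ρ - N| ≤ |-(N * A)| + |ρ * A ^ 2| := hexpand ▸ abs_add_le _ _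
    _ = |N| * |A| + |ρ| * A ^ 2 := by
        rw [abs_neg, abs_mul, abs_mul, abs_of_nonneg (sq_nonneg A)]
    _ ≤ |N| * |A| + R * A ^ 2 := by gcongr

theorem expect_abs_mul_abs_le {ι : Type*} [Fintype ι] {N A : ι → ℝ} {v R : ℝ} (hv : 0 ≤ v)
    (hR : 0 ≤ R) (hN : 𝔼 i, N i ^ 2 ≤ R ^ 2 * v) (hA : 𝔼 i, A i ^ 2 ≤ v) :
    𝔼 i, |N i| * |A i| ≤ R * v := by
  refine le_of_sq_le_sq ?_ (by positivity)
  calc (𝔼 i, |N i| * |A i|) ^ 2 ≤ (𝔼 i, |N i| ^ 2) * 𝔼 i, |A i| ^ 2 :=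
        Finset.expect_mul_sq_le_sq_mul_sq _ _ _
    _ ≤ R ^ 2 * v * v := by
        simp only [sq_abs]
        exact mul_le_mul hN hA (Finset.expect_nonneg fun i _ => sq_nonneg _) (by positivity)
    _ = (R * v) ^ 2 := by ring

theorem abs_expect_batch_centerMass_le_of_centered {w f : X → ℝ} (hw : ∀ x, 0 < w x)
    (hw1 : 𝔼 x, w x = 1) {R : ℝ} (hf : ∀ x, |f x| ≤ R) (hf0 : 𝔼 x, w x * f x = 0)
    {m : ℕ} (hm : 0 < m) :
    |𝔼 ω : Fin m → X, Finset.univ.centerMass (fun j => w (ω j)) fun j => f (ω j)| ≤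
      2 * R * Fintype.card X / m := by
  have : Nonempty (Fin m) := ⟨⟨0, hm⟩⟩
  have hR : 0 ≤ R := (abs_nonneg _).trans (hf (Classical.arbitrary X))
  let v : ℝ := Fintype.card X / m
  let N : (Fin m → X) → ℝ := fun ω => 𝔼 j, w (ω j) * f (ω j)
  let A : (Fin m → X) → ℝ := fun ω => 𝔼 j, (w (ω j) - 1)
  let ρ : (Fin m → X) → ℝ := fun ω =>
    Finset.univ.centerMass (fun j => w (ω j)) fun j => f (ω j)
  have hρN : ∀ ω, |ρ ω - N ω| ≤ |N ω| * |A ω| + R * A ω ^ 2 := fun ω => by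
    have hρR : ‖ρ ω‖ ≤ R := norm_centerMass_le (fun j => hw (ω j)) fun j => hf (ω j)
    refine abs_sub_le_of_mul_one_add_eq ?_ hρR
    have hW : ∑ j, w (ω j) ≠ 0 := (Finset.sum_pos (fun j _ => hw _) Finset.univ_nonempty).ne'
    have h_one_add : 1 + A ω = 𝔼 j, w (ω j) := by
      simp only [A, Finset.expect_sub_distrib, Fintype.expect_const, add_sub_cancel]
    rw [h_one_add]
    simp only [ρ, N, Finset.centerMass, Fintype.expect_eq_sum_div_card, smul_eq_mul]
    field_simp
  have hw1' : 𝔼 x, (w x - 1) = 0 := by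
    rw [Finset.expect_sub_distrib, hw1, Fintype.expect_const, sub_self]
  have hA2 : 𝔼 ω, A ω ^ 2 ≤ v :=
    (expect_batch_mean_sq hw1' m).trans_le
      (div_le_div_of_nonneg_right (expect_sub_one_sq_le_card (fun x => (hw x).le) hw1)
        m.cast_nonneg)
  have hN2 : 𝔼 ω, N ω ^ 2 ≤ R ^ 2 * v := by
    rw [expect_batch_mean_sq hf0 m, ← mul_div_assoc]
    exact div_le_div_of_nonneg_right (expect_mul_sq_le_card (fun x => (hw x).le) hw1 hf)
      m.cast_nonneg
  calc |𝔼 ω, ρ ω| = |𝔼 ω, (ρ ω - N ω)| := by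
        rw [Finset.expect_sub_distrib, expect_batch_mean_eq_zero hf0, sub_zero]
    _ ≤ 𝔼 ω, (|N ω| * |A ω| + R * A ω ^ 2) :=
        (Finset.abs_expect_le _ _).trans (Finset.expect_le_expect fun ω _ => hρN ω)
    _ ≤ R * v + R * v := by
        rw [Finset.expect_add_distrib, ← Finset.mul_expect]
        gcongr
        exact expect_abs_mul_abs_le (by positivity) hR hN2 hA2
    _ = 2 * R * Fintype.card X / m := by simp only [v]; ring

theorem abs_expect_batch_centerMass_sub_le {g f : X → ℝ} (hg : ∀ x, 0 < g x) {R : ℝ}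
    (hf : ∀ x, |f x| ≤ R) {m : ℕ} (hm : 0 < m) :
    |(𝔼 ω : Fin m → X, Finset.univ.centerMass (fun j => g (ω j)) fun j => f (ω j)) -
      Finset.univ.centerMass g f| ≤ 4 * R * Fintype.card X / m := by
  have : Nonempty (Fin m) := ⟨⟨0, hm⟩⟩
  let μ := Finset.univ.centerMass g f
  have hμ : ‖μ‖ ≤ R := norm_centerMass_le hg hf
  have hS : 0 < 𝔼 x, g x := Finset.expect_pos (fun x _ => hg x) Finset.univ_nonempty
  let w : X → ℝ := fun x => (𝔼 x, g x)⁻¹ * g x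
  have hw : ∀ x, 0 < w x := fun x => mul_pos (inv_pos.2 hS) (hg x)
  have hw1 : 𝔼 x, w x = 1 := by rw [← Finset.mul_expect, inv_mul_cancel₀ hS.ne']
  have hcenter : ∀ ω : Fin m → X,
      (Finset.univ.centerMass (fun j => w (ω j)) fun j => f (ω j) - μ) =
        (Finset.univ.centerMass (fun j => g (ω j)) fun j => f (ω j)) - μ := fun ω => by
    have hW : ∑ j, g (ω j) ≠ 0 := (Finset.sum_pos (fun j _ => hg _) Finset.univ_nonempty).ne'
    rw [show (fun j => w (ω j)) = (𝔼 x, g x)⁻¹ • fun j => g (ω j) from rfl,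
      Finset.centerMass_smul_left _ (hc := inv_ne_zero hS.ne')]
    simp only [Finset.centerMass, smul_eq_mul, mul_sub, Finset.sum_sub_distrib, ← Finset.sum_mul,
      inv_mul_cancel_left₀ hW]
  have hf0 : 𝔼 x, w x * (f x - μ) = 0 := by
    have hW : ∑ x, g x ≠ 0 := (Finset.sum_pos (fun x _ => hg x) Finset.univ_nonempty).ne'
    simp only [w, μ, mul_assoc, ← Finset.mul_expect, mul_sub, Finset.expect_sub_distrib,
      ← Finset.expect_mul, Finset.centerMass, Fintype.expect_eq_sum_div_card, smul_eq_mul]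
    field_simp
    simp
  have hbias := abs_expect_batch_centerMass_le_of_centered hw hw1
    (fun x => (abs_sub _ _).trans (add_le_add (hf x) hμ)) hf0 hm
  simp only [hcenter, Finset.expect_sub_distrib, Fintype.expect_const] at hbias
  refine hbias.trans_eq ?_
  ring

end Batch

section MetricProjection

variable {H : Type*} [NormedAddCommGroup H] [InnerProductSpace ℝ H]

/-- `π` is the metric projection onto the convex set `K`, characterized by its variational
inequality. -/
structure IsProjOnto (K : Set H) (π : H → H) : Prop where
  mem : ∀ w, π w ∈ K
  inner_le : ∀ w, ∀ z ∈ K, ⟪w - π w, z - π w⟫ ≤ 0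

theorem norm_sub_le_of_inner_le_zero {w v p q : H} (hp : ⟪w - p, q - p⟫ ≤ 0)
    (hq : ⟪v - q, p - q⟫ ≤ 0) : ‖p - q‖ ≤ ‖w - v‖ := by
  have hsplit : ⟪w - v, p - q⟫ = ‖p - q‖ ^ 2 - ⟪w - p, q - p⟫ - ⟪v - q, p - q⟫ := by
    rw [← real_inner_self_eq_norm_sq, ← neg_sub p q, inner_neg_right, sub_neg_eq_add,
      ← inner_add_left, ← inner_sub_left]
    congr 1
    abel
  have hcauchy := real_inner_le_norm (w - v) (p - q)
  by_contra! hlt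
  nlinarith [norm_nonneg (w - v)]

namespace IsProjOnto

variable {K : Set H} {π : H → H}

theorem norm_sub_le (h : IsProjOnto K π) (w v : H) : ‖π w - π v‖ ≤ ‖w - v‖ :=
  norm_sub_le_of_inner_le_zero (h.inner_le w _ (h.mem v)) (h.inner_le v _ (h.mem w))

theorem eq_of_inner_le (h : IsProjOnto K π) {w y : H} (hy : y ∈ K)
    (hw : ∀ z ∈ K, ⟪w - y, z - y⟫ ≤ 0) : π w = y := by
  have hle := norm_sub_le_of_inner_le_zero (h.inner_le w y hy) (hw _ (h.mem w))
  rwa [sub_self, norm_zero, norm_le_zero_iff, sub_eq_zero] at hle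

theorem apply_of_mem (h : IsProjOnto K π) {z : H} (hz : z ∈ K) : π z = z :=
  h.eq_of_inner_le hz fun _ _ => by rw [sub_self, inner_zero_left]

theorem norm_step_sq_le (h : IsProjOnto K π) {z : H} (hz : z ∈ K) (u s : H) (γ : ℝ) :
    ‖π (u - γ • s) - z‖ ^ 2 ≤ ‖u - z‖ ^ 2 - 2 * γ * ⟪s, u - z⟫ + γ ^ 2 * ‖s‖ ^ 2 := by
  calc ‖π (u - γ • s) - z‖ ^ 2 = ‖π (u - γ • s) - π z‖ ^ 2 := by rw [h.apply_of_mem hz]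
    _ ≤ ‖u - γ • s - z‖ ^ 2 := by gcongr; exact h.norm_sub_le _ _
    _ = ‖(u - z) - γ • s‖ ^ 2 := by rw [sub_right_comm]
    _ = ‖u - z‖ ^ 2 - 2 * γ * ⟪s, u - z⟫ + γ ^ 2 * ‖s‖ ^ 2 := by
      rw [norm_sub_sq_real, inner_smul_right, norm_smul, mul_pow, Real.norm_eq_abs, sq_abs,
        real_inner_comm]
      ring

theorem prod {H' : Type*} [NormedAddCommGroup H'] [InnerProductSpace ℝ H'] {K' : Set H'}
    {π' : H' → H'} (h : IsProjOnto K π) (h' : IsProjOnto K' π') :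
    IsProjOnto {u : WithLp 2 (H × H') | u.fst ∈ K ∧ u.snd ∈ K'}
      fun u => WithLp.toLp 2 (π u.fst, π' u.snd) where
  mem w := ⟨h.mem w.fst, h'.mem w.snd⟩
  inner_le w z hz := by
    rw [WithLp.prod_inner_apply]
    exact add_nonpos (h.inner_le w.fst z.fst hz.1) (h'.inner_le w.snd z.snd hz.2)

end IsProjOnto

theorem isProjOnto_Ici (a : ℝ) : IsProjOnto (Set.Ici a) fun x => max x a where
  mem x := le_max_right x a
  inner_le x z hz := by
    rcases le_total a x with hx | hx
    · simp [max_eq_left hx]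
    · rw [max_eq_right hx]
      exact mul_nonpos_of_nonneg_of_nonpos (sub_nonneg.2 hz) (sub_nonpos.2 hx)

theorem isProjOnto_proj {d : ℕ} {K : Set (EuclideanSpace ℝ (Fin d))} (hne : K.Nonempty)
    (hcl : IsClosed K) (hK : Convex ℝ K) : IsProjOnto K (proj K) := by
  have hspec : ∀ x, proj K x ∈ K ∧ ∀ z ∈ K, dist x (proj K x) ≤ dist x z := fun x => by
    obtain ⟨y, hy, hxy⟩ := hcl.exists_infDist_eq_dist hne x
    exact Classical.epsilon_spec (p := fun y => y ∈ K ∧ ∀ z ∈ K, dist x y ≤ dist x z)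
      ⟨y, hy, fun z hz => hxy ▸ Metric.infDist_le_dist_of_mem hz⟩
  refine ⟨fun x => (hspec x).1, fun x => ?_⟩
  rw [← norm_eq_iInf_iff_real_inner_le_zero hK (hspec x).1]
  have : Nonempty K := hne.to_subtype
  refine le_antisymm (le_ciInf fun z => ?_) (ciInf_le ⟨0, ?_⟩ (⟨_, (hspec x).1⟩ : K))
  · simpa only [dist_eq_norm] using (hspec x).2 z z.2
  · rintro _ ⟨z, rfl⟩
    exact norm_nonneg _

end MetricProjection

section WeakConvexity

variable {H : Type*} [NormedAddCommGroup H] [InnerProductSpace ℝ H]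

/-- `f`, with gradient `f'`, lies above its tangents on `S` up to a quadratic error: the first-order
form of weak convexity with modulus `2 * ρ`. For `ρ = 0` it is the gradient inequality of convex
functions. -/
def WeaklyConvexOn (ρ : ℝ) (f : H → ℝ) (f' : H → H) (S : Set H) : Prop :=
  ∀ x ∈ S, ∀ y ∈ S, f x + ⟪f' x, y - x⟫ - ρ * ‖y - x‖ ^ 2 ≤ f y

variable [CompleteSpace H] {S : Set H} {f : H → ℝ} {f' : H → H}

theorem weaklyConvexOn_zero_of_convexOn (hf : ConvexOn ℝ S f)
    (hf' : ∀ x ∈ S, HasGradientAt f (f' x) x) : WeaklyConvexOn 0 f f' S := by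
  intro x hx y hy
  have hline : HasDerivAt (f ∘ AffineMap.lineMap x y) ⟪f' x, y - x⟫ (0 : ℝ) := by
    have hx' : HasFDerivAt f (InnerProductSpace.toDual ℝ H (f' x))
        (AffineMap.lineMap x y (0 : ℝ)) := by
      rw [AffineMap.lineMap_apply_zero]
      exact (hf' x hx).hasFDerivAt
    exact hx'.comp_hasDerivAt 0 AffineMap.hasDerivAt_lineMap
  have hslope := (hf.comp_affineMap (AffineMap.lineMap x y : ℝ →ᵃ[ℝ] H)).le_slope_of_hasDerivAt
    (x := 0) (y := 1) (by simpa using hx) (by simpa using hy) zero_lt_one hline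
  simp only [slope_def_field, Function.comp_apply, AffineMap.lineMap_apply_zero,
    AffineMap.lineMap_apply_one, sub_zero, div_one] at hslope
  linarith

theorem weaklyConvexOn_of_lipschitz_gradient (hS : Convex ℝ S) {L : ℝ} (hL : 0 ≤ L)
    (hf : ∀ x ∈ S, HasGradientAt f (f' x) x)
    (hlip : ∀ x ∈ S, ∀ y ∈ S, ‖f' x - f' y‖ ≤ L * ‖x - y‖) : WeaklyConvexOn L f f' S := by
  intro x hx y hy
  have hseg : segment ℝ x y ⊆ S := hS.segment_subset hx hy
  have herror := Convex.norm_image_sub_le_of_norm_hasFDerivWithin_le'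
    (f' := fun z => InnerProductSpace.toDual ℝ H (f' z)) (C := L * ‖y - x‖)
    (φ := InnerProductSpace.toDual ℝ H (f' x)) (s := segment ℝ x y)
    (fun z hz => (hf z (hseg hz)).hasFDerivAt.hasFDerivWithinAt)
    (fun z hz => by
      rw [← map_sub, LinearIsometryEquiv.norm_map]
      refine (hlip z (hseg hz) x hx).trans (mul_le_mul_of_nonneg_left ?_ hL)
      simpa only [norm_sub_rev] using norm_sub_le_of_mem_segment hz)
    (convex_segment x y) (left_mem_segment ℝ x y) (right_mem_segment ℝ x y)
  rw [Real.norm_eq_abs, InnerProductSpace.toDual_apply_apply] at herror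
  linarith [(abs_le.1 herror).1]

theorem abs_sub_le_of_norm_gradient_le (hS : Convex ℝ S) {G : ℝ}
    (hf : ∀ x ∈ S, HasGradientAt f (f' x) x) (hG : ∀ x ∈ S, ‖f' x‖ ≤ G) {x y : H} (hx : x ∈ S)
    (hy : y ∈ S) : |f y - f x| ≤ G * ‖y - x‖ :=
  hS.norm_image_sub_le_of_norm_hasFDerivWithin_le
    (fun z hz => (hf z hz).hasFDerivAt.hasFDerivWithinAt)
    (fun z hz => by rw [LinearIsometryEquiv.norm_map]; exact hG z hz) hx hy

end WeakConvexity

section Prox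

variable {H : Type*} [NormedAddCommGroup H]

/-- `y` is a proximal point of `u` for the function `F` on `K`: a minimizer over `K` of
`F + κ ‖· - u‖²`. For `κ = 0` it is a minimizer of `F`. -/
structure IsProx (F : H → ℝ) (K : Set H) (κ : ℝ) (u y : H) : Prop where
  mem : y ∈ K
  isMinOn : IsMinOn (fun z => F z + κ * ‖z - u‖ ^ 2) K y

variable {F : H → ℝ} {F' : H → H} {K : Set H} {κ : ℝ} {u y : H}

theorem IsProx.le (h : IsProx F K κ u y) {z : H} (hz : z ∈ K) :
    F y + κ * ‖y - u‖ ^ 2 ≤ F z + κ * ‖z - u‖ ^ 2 :=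
  h.isMinOn hz

variable [InnerProductSpace ℝ H]

theorem IsProx.inner_gradient_le (h : IsProx F K κ u y) {ρ : ℝ} (hF : WeaklyConvexOn ρ F F' K)
    (hu : u ∈ K) : ⟪F' u, y - u⟫ ≤ -((κ - ρ) * ‖y - u‖ ^ 2) := by
  have hmin := h.le hu
  rw [sub_self, norm_zero] at hmin
  linarith [hF u hu y h.mem]

variable [CompleteSpace H]

theorem inner_gradient_nonneg_of_isMinOn {f : H → ℝ} {v : H} (hK : Convex ℝ K) (hy : y ∈ K)
    (hmin : IsMinOn f K y) (hf : HasGradientAt f v y) {z : H} (hz : z ∈ K) : 0 ≤ ⟪v, z - y⟫ :=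
  hmin.localize.hasFDerivWithinAt_nonneg hf.hasFDerivAt.hasFDerivWithinAt
    (sub_mem_posTangentConeAt_of_segment_subset (hK.segment_subset hy hz))

theorem hasGradientAt_add {f f' : H → ℝ} {v v' : H} (hf : HasGradientAt f v y)
    (hf' : HasGradientAt f' v' y) : HasGradientAt (fun z => f z + f' z) (v + v') y := by
  rw [hasGradientAt_iff_hasFDerivAt, map_add]
  exact hf.hasFDerivAt.add hf'.hasFDerivAt

theorem hasGradientAt_mul_norm_sub_sq (κ : ℝ) (u y : H) :
    HasGradientAt (fun z => κ * ‖z - u‖ ^ 2) ((2 * κ) • (y - u)) y := by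
  rw [hasGradientAt_iff_hasFDerivAt]
  refine (((hasFDerivAt_id y).sub_const u).norm_sq.const_mul κ).congr_fderiv ?_
  ext v
  simp
  ring

theorem IsProx.inner_nonneg (h : IsProx F K κ u y) (hK : Convex ℝ K)
    (hF : HasGradientAt F (F' y) y) {z : H} (hz : z ∈ K) :
    0 ≤ ⟪F' y + (2 * κ) • (y - u), z - y⟫ :=
  inner_gradient_nonneg_of_isMinOn hK h.mem h.isMinOn
    (hasGradientAt_add hF (hasGradientAt_mul_norm_sub_sq κ u y)) hz

theorem IsProx.norm_gradMap_le (h : IsProx F K κ u y) (hK : Convex ℝ K) {π : H → H}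
    (hπ : IsProjOnto K π) (hκ : 0 ≤ κ) (hF : HasGradientAt F (F' y) y) {Λ : ℝ}
    (hΛ : ‖F' y - F' u‖ ≤ Λ * ‖y - u‖) {r : ℝ} (hr : 0 < r) :
    ‖r⁻¹ • (u - π (u - r • F' u))‖ ≤ (2 / r + Λ + 2 * κ) * ‖y - u‖ := by
  let p := y - r • (F' y + (2 * κ) • (y - u))
  have hfix : π p = y := hπ.eq_of_inner_le h.mem fun z hz => by
    rw [sub_sub_cancel_left, inner_neg_left, real_inner_smul_left]
    exact neg_nonpos.2 (mul_nonneg hr.le (h.inner_nonneg hK hF hz))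
  have hdist : ‖p - (u - r • F' u)‖ ≤ ‖y - u‖ + r * (Λ * ‖y - u‖) + r * (2 * κ * ‖y - u‖) := by
    have hsplit : p - (u - r • F' u) = (y - u) - r • (F' y - F' u) - r • (2 * κ) • (y - u) := by
      module
    rw [hsplit]
    refine (norm_sub_le _ _).trans (add_le_add ((norm_sub_le _ _).trans ?_) ?_)
    · rw [norm_smul, Real.norm_of_nonneg hr.le]
      gcongr
    · rw [norm_smul, norm_smul, Real.norm_of_nonneg hr.le, Real.norm_of_nonneg (by positivity)]
  have hnear : ‖u - π (u - r • F' u)‖ ≤ ‖y - u‖ + ‖p - (u - r • F' u)‖ := by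
    calc ‖u - π (u - r • F' u)‖ ≤ ‖u - y‖ + ‖π p - π (u - r • F' u)‖ := by
          rw [hfix]; exact norm_sub_le_norm_sub_add_norm_sub _ _ _
      _ ≤ ‖y - u‖ + ‖p - (u - r • F' u)‖ := by
          rw [norm_sub_rev]; gcongr; exact hπ.norm_sub_le _ _
  rw [norm_smul, Real.norm_of_nonneg (by positivity), inv_mul_le_iff₀ hr]
  refine (hnear.trans (add_le_add_right hdist _)).trans_eq ?_
  field_simp
  ring

end Prox

section Gibbs

variable {ι : Type*} [Fintype ι]

/-- The Gibbs weights (softmax) of a finite family of exponents. -/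
def gibbs (a : ι → ℝ) (i : ι) : ℝ :=
  Real.exp (a i) / ∑ j, Real.exp (a j)

theorem centerMass_exp {E : Type*} [AddCommGroup E] [Module ℝ E] (a : ι → ℝ) (s : ι → E) :
    Finset.univ.centerMass (fun i => Real.exp (a i)) s = ∑ i, gibbs a i • s i := by
  simp only [Finset.centerMass, gibbs, Finset.smul_sum, smul_smul, div_eq_inv_mul]

theorem gibbs_nonneg (a : ι → ℝ) (i : ι) : 0 ≤ gibbs a i := by
  unfold gibbs
  positivity

variable [Nonempty ι]

theorem sum_exp_pos (a : ι → ℝ) : 0 < ∑ i, Real.exp (a i) :=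
  Finset.sum_pos (fun _ _ => Real.exp_pos _) Finset.univ_nonempty

theorem sum_gibbs (a : ι → ℝ) : ∑ i, gibbs a i = 1 := by
  simp only [gibbs]
  rw [← Finset.sum_div, div_self (sum_exp_pos a).ne']

theorem one_sub_mul_gibbs_le {a b : ι → ℝ} {x : ℝ} (hab : ∀ i, |a i - b i| ≤ x) (i : ι) :
    (1 - 2 * x) * gibbs a i ≤ gibbs b i := by
  have hnum : Real.exp (-x) * Real.exp (a i) ≤ Real.exp (b i) := by
    rw [← Real.exp_add]
    exact Real.exp_le_exp.2 (by linarith [(abs_le.1 (hab i)).2])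
  have hden : Real.exp (-x) * ∑ j, Real.exp (b j) ≤ ∑ j, Real.exp (a j) := by
    rw [Finset.mul_sum]
    gcongr with j
    rw [← Real.exp_add]
    exact Real.exp_le_exp.2 (by linarith [(abs_le.1 (hab j)).1])
  calc (1 - 2 * x) * gibbs a i ≤ Real.exp (-x + -x) * gibbs a i := by
        gcongr
        · exact gibbs_nonneg a i
        · linarith [Real.add_one_le_exp (-x + -x)]
    _ ≤ gibbs b i := by
        rw [gibbs, gibbs, ← mul_div_assoc, div_le_div_iff₀ (sum_exp_pos a) (sum_exp_pos b)]
        calc Real.exp (-x + -x) * Real.exp (a i) * ∑ j, Real.exp (b j)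
            = (Real.exp (-x) * Real.exp (a i)) * (Real.exp (-x) * ∑ j, Real.exp (b j)) := by
              rw [Real.exp_add]; ring
          _ ≤ Real.exp (b i) * ∑ j, Real.exp (a j) := by gcongr

theorem sum_abs_gibbs_sub_le {a b : ι → ℝ} {x : ℝ} (hab : ∀ i, |a i - b i| ≤ x) :
    ∑ i, |gibbs a i - gibbs b i| ≤ 4 * x := by
  have hx : 0 ≤ x := (abs_nonneg _).trans (hab (Classical.arbitrary ι))
  calc ∑ i, |gibbs a i - gibbs b i| ≤ ∑ i, 2 * x * (gibbs a i + gibbs b i) := by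
        gcongr with i
        have hba := one_sub_mul_gibbs_le hab i
        have hab' := one_sub_mul_gibbs_le (fun j => abs_sub_comm (a j) (b j) ▸ hab j) i
        have ha := mul_nonneg hx (gibbs_nonneg a i)
        have hb := mul_nonneg hx (gibbs_nonneg b i)
        exact abs_le.2 ⟨by linarith, by linarith⟩
    _ = 4 * x := by
        rw [← Finset.mul_sum, Finset.sum_add_distrib, sum_gibbs, sum_gibbs]
        ring

theorem norm_centerMass_exp_sub_le {E : Type*} [NormedAddCommGroup E] [NormedSpace ℝ E]
    {a b : ι → ℝ} {s s' : ι → E} {x G D : ℝ} (hab : ∀ i, |a i - b i| ≤ x)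
    (hs : ∀ i, ‖s i‖ ≤ G) (hD : ∀ i, ‖s i - s' i‖ ≤ D) :
    ‖Finset.univ.centerMass (fun i => Real.exp (a i)) s -
      Finset.univ.centerMass (fun i => Real.exp (b i)) s'‖ ≤ 4 * x * G + D := by
  have hG : 0 ≤ G := (norm_nonneg _).trans (hs (Classical.arbitrary ι))
  have hsplit : Finset.univ.centerMass (fun i => Real.exp (a i)) s -
      Finset.univ.centerMass (fun i => Real.exp (b i)) s' =
        ∑ i, (gibbs a i - gibbs b i) • s i + ∑ i, gibbs b i • (s i - s' i) := by
    simp only [centerMass_exp, sub_smul, smul_sub, Finset.sum_sub_distrib]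
    abel
  rw [hsplit]
  refine (norm_add_le _ _).trans (add_le_add ?_ ?_)
  · calc ‖∑ i, (gibbs a i - gibbs b i) • s i‖ ≤ ∑ i, |gibbs a i - gibbs b i| * G := by
          refine norm_sum_le_of_le _ fun i _ => ?_
          rw [norm_smul, Real.norm_eq_abs]
          gcongr
          exact hs i
      _ ≤ 4 * x * G := by
          rw [← Finset.sum_mul]
          gcongr
          exact sum_abs_gibbs_sub_le hab
  · rw [← centerMass_exp]
    exact norm_centerMass_le (fun i => Real.exp_pos _) hD

end Gibbs

section SoftMean

variable {ι : Type*} [Fintype ι] {η : ℝ}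

/-- The log-exp mean of a finite family with smoothing parameter `η`, which smooths its maximum. -/
def softMean (η : ℝ) (a : ι → ℝ) : ℝ :=
  1 / η * Real.log (∑ i, 1 / (Fintype.card ι : ℝ) * Real.exp (η * a i))

variable [Nonempty ι]

theorem softMean_eq (η : ℝ) (a : ι → ℝ) :
    softMean η a = (Real.log (∑ i, Real.exp (η * a i)) - Real.log (Fintype.card ι)) / η := by
  have hsum : ∑ i, Real.exp (η * a i) ≠ 0 := (sum_exp_pos _).ne'
  have hcard : (Fintype.card ι : ℝ) ≠ 0 := by exact_mod_cast Fintype.card_ne_zero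
  rw [softMean, ← Finset.mul_sum, one_div_mul_eq_div (Fintype.card ι : ℝ),
    Real.log_div hsum hcard, one_div_mul_eq_div]

theorem sub_le_softMean (hη : 0 < η) (a : ι → ℝ) (i : ι) :
    a i - Real.log (Fintype.card ι) / η ≤ softMean η a := by
  have hi : η * a i ≤ Real.log (∑ j, Real.exp (η * a j)) := by
    rw [Real.le_log_iff_exp_le (sum_exp_pos _)]
    exact Finset.single_le_sum (f := fun j => Real.exp (η * a j))
      (fun j _ => (Real.exp_pos _).le) (Finset.mem_univ i)
  rw [softMean_eq, sub_div]
  gcongr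
  rwa [le_div_iff₀' hη]

theorem sum_gibbs_mul_sub_le_softMean_sub (hη : 0 < η) (a b : ι → ℝ) :
    ∑ i, gibbs (fun j => η * a j) i * (b i - a i) ≤ softMean η b - softMean η a := by
  have ha := sum_exp_pos fun i => η * a i
  have hb := sum_exp_pos fun i => η * b i
  have hjensen := convexOn_exp.map_sum_le (t := Finset.univ)
    (w := gibbs fun j => η * a j) (p := fun i => η * (b i - a i))
    (fun i _ => gibbs_nonneg _ i) (sum_gibbs _) fun _ _ => Set.mem_univ _
  have htilt : ∑ i, gibbs (fun j => η * a j) i • Real.exp (η * (b i - a i)) =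
      (∑ i, Real.exp (η * b i)) / ∑ i, Real.exp (η * a i) := by
    rw [Finset.sum_div]
    refine Finset.sum_congr rfl fun i _ => ?_
    rw [gibbs, smul_eq_mul, div_mul_eq_mul_div, ← Real.exp_add]
    congr 2
    ring
  rw [htilt, ← Real.le_log_iff_exp_le (div_pos hb ha), Real.log_div hb.ne' ha.ne'] at hjensen
  simp only [smul_eq_mul, mul_left_comm _ η, ← Finset.mul_sum] at hjensen
  rw [softMean_eq, softMean_eq, ← sub_div, sub_sub_sub_cancel_right, le_div_iff₀' hη]
  exact hjensen

variable {H : Type*} [NormedAddCommGroup H] [InnerProductSpace ℝ H]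

theorem weaklyConvexOn_softMean (hη : 0 < η) {S : Set H} {ρ : ℝ} {a : ι → H → ℝ} {s : ι → H → H}
    (h : ∀ i, WeaklyConvexOn ρ (a i) (s i) S) :
    WeaklyConvexOn ρ (fun u => softMean η fun i => a i u)
      (fun u => Finset.univ.centerMass (fun i => Real.exp (η * a i u)) fun i => s i u) S := by
  intro u hu v hv
  have htangent : ⟪Finset.univ.centerMass (fun i => Real.exp (η * a i u)) (fun i => s i u), v - u⟫ -
      ρ * ‖v - u‖ ^ 2 ≤ ∑ i, gibbs (fun j => η * a j u) i * (a i v - a i u) := by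
    calc _ = ∑ i, gibbs (fun j => η * a j u) i * (⟪s i u, v - u⟫ - ρ * ‖v - u‖ ^ 2) := by
          simp only [centerMass_exp, sum_inner, real_inner_smul_left, mul_sub,
            Finset.sum_sub_distrib, ← Finset.sum_mul, sum_gibbs, one_mul]
      _ ≤ ∑ i, gibbs (fun j => η * a j u) i * (a i v - a i u) := by
          refine Finset.sum_le_sum fun i _ => mul_le_mul_of_nonneg_left ?_ (gibbs_nonneg _ i)
          linarith [h i u hu v hv]
  linarith [sum_gibbs_mul_sub_le_softMean_sub hη (fun i => a i u) fun i => a i v]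

theorem hasGradientAt_softMean [CompleteSpace H] (hη : η ≠ 0) {a : ι → H → ℝ} {s : ι → H} {u : H}
    (h : ∀ i, HasGradientAt (a i) (s i) u) :
    HasGradientAt (fun v => softMean η fun i => a i v)
      (Finset.univ.centerMass (fun i => Real.exp (η * a i u)) s) u := by
  have hexp : ∀ i, HasFDerivAt (fun v => Real.exp (η * a i v))
      (Real.exp (η * a i u) • η • InnerProductSpace.toDual ℝ H (s i)) u :=
    fun i => ((h i).hasFDerivAt.const_mul η).exp
  have hlog := (((HasFDerivAt.fun_sum fun i (_ : i ∈ Finset.univ) => hexp i).log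
    (sum_exp_pos _).ne').sub_const (Real.log (Fintype.card ι))).const_mul η⁻¹
  rw [hasGradientAt_iff_hasFDerivAt]
  simp only [softMean_eq, div_eq_inv_mul]
  refine hlog.congr_fderiv ?_
  simp only [Finset.centerMass, map_smul, map_sum, smul_comm _ η, ← Finset.smul_sum,
    smul_inv_smul₀ hη]

end SoftMean

section ProductSpace

theorem norm_le_norm_fst_add_norm_snd {E F : Type*} [SeminormedAddCommGroup E]
    [SeminormedAddCommGroup F] (w : WithLp 2 (E × F)) : ‖w‖ ≤ ‖w.fst‖ + ‖w.snd‖ := by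
  have hsq := WithLp.prod_norm_sq_eq_of_L2 w
  nlinarith [norm_nonneg w.fst, norm_nonneg w.snd, norm_nonneg w]

variable {E F : Type*} [NormedAddCommGroup E] [InnerProductSpace ℝ E] [CompleteSpace E]
  [NormedAddCommGroup F] [InnerProductSpace ℝ F] [CompleteSpace F]

theorem hasGradientAt_fst_add_snd {f : E → ℝ} {f' : F → ℝ} {u v : WithLp 2 (E × F)}
    (hf : HasGradientAt f v.fst u.fst) (hf' : HasGradientAt f' v.snd u.snd) :
    HasGradientAt (fun w : WithLp 2 (E × F) => f w.fst + f' w.snd) v u := by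
  rw [hasGradientAt_iff_hasFDerivAt]
  refine ((hf.hasFDerivAt.comp u (WithLp.fstL 2 ℝ E F).hasFDerivAt).add
    (hf'.hasFDerivAt.comp u (WithLp.sndL 2 ℝ E F).hasFDerivAt)).congr_fderiv ?_
  ext w
  simp [WithLp.prod_inner_apply]

theorem hasGradientAt_partial_fst {f : WithLp 2 (E × F) → ℝ} {u v : WithLp 2 (E × F)}
    (hf : HasGradientAt f v u) :
    HasGradientAt (fun x => f (WithLp.toLp 2 (x, u.snd))) v.fst u.fst := by
  have hembed : HasFDerivAt (fun x => (WithLp.toLp 2 (x, u.snd) : WithLp 2 (E × F)))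
      ((WithLp.prodContinuousLinearEquiv 2 ℝ E F).symm.toContinuousLinearMap ∘L
        ContinuousLinearMap.inl ℝ E F) u.fst :=
    (WithLp.prodContinuousLinearEquiv 2 ℝ E F).symm.hasFDerivAt.comp _ (hasFDerivAt_prodMk_left _ _)
  rw [hasGradientAt_iff_hasFDerivAt]
  refine (HasFDerivAt.comp u.fst (g := f) hf.hasFDerivAt hembed).congr_fderiv ?_
  ext w
  simp [WithLp.prod_inner_apply]

theorem hasGradientAt_partial_snd {f : WithLp 2 (E × F) → ℝ} {u v : WithLp 2 (E × F)}
    (hf : HasGradientAt f v u) :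
    HasGradientAt (fun y => f (WithLp.toLp 2 (u.fst, y))) v.snd u.snd := by
  have hembed : HasFDerivAt (fun y => (WithLp.toLp 2 (u.fst, y) : WithLp 2 (E × F)))
      ((WithLp.prodContinuousLinearEquiv 2 ℝ E F).symm.toContinuousLinearMap ∘L
        ContinuousLinearMap.inr ℝ E F) u.snd :=
    (WithLp.prodContinuousLinearEquiv 2 ℝ E F).symm.hasFDerivAt.comp _
      (hasFDerivAt_prodMk_right _ _)
  rw [hasGradientAt_iff_hasFDerivAt]
  refine (HasFDerivAt.comp u.snd (g := f) hf.hasFDerivAt hembed).congr_fderiv ?_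
  ext w
  simp [WithLp.prod_inner_apply]

end ProductSpace

theorem exists_norm_gradient_le_of_smoothOn {d : ℕ} {L : ℝ} {f : EuclideanSpace ℝ (Fin d) → ℝ}
    {S : Set (EuclideanSpace ℝ (Fin d))} (hf : SmoothOn L f S) (hS : IsCompact S) :
    ∃ G, ∀ x ∈ S, ‖gradient f x‖ ≤ G := by
  have hlip : LipschitzOnWith L.toNNReal (gradient f) S :=
    LipschitzOnWith.of_dist_le_mul fun x hx y hy => by
      rw [dist_eq_norm, dist_eq_norm]
      exact (hf.2 x hx y hy).trans (by gcongr; exact Real.le_coe_toNNReal L)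
  exact hS.exists_bound_of_continuousOn hlip.continuousOn

/-- The space of the pairs `(θ, λ)`, with its Euclidean norm. The iterates live in the plain
product, whose norm is the maximum norm. -/
abbrev Joint (d : ℕ) : Type := WithLp 2 (EuclideanSpace ℝ (Fin d) × ℝ)

namespace Problem

variable {d q k : ℕ} (P : Problem d q k)

/-- The feasible set `Θ × [0, ∞)`. -/
def feas : Set (Joint d) := {u | u.fst ∈ P.Θ ∧ u.snd ∈ Set.Ici 0}

/-- The Euclidean projection onto the feasible set, which acts on each component. -/
def projFeas (u : Joint d) : Joint d := WithLp.toLp 2 (proj P.Θ u.fst, max u.snd 0)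

/-- The exponent `l̂(θ, ζ) - λ ‖x - ζ‖²` of the objective. -/
def expo (x ζ : P.𝒳) (u : Joint d) : ℝ :=
  P.lhat u.fst ζ - u.snd * ‖(x : EuclideanSpace ℝ (Fin q)) - ζ‖ ^ 2

/-- The gradient of the exponent `P.expo x ζ`. -/
def score (x ζ : P.𝒳) (u : Joint d) : Joint d :=
  WithLp.toLp 2 (gradient (fun θ => P.lhat θ ζ) u.fst,
    -‖(x : EuclideanSpace ℝ (Fin q)) - ζ‖ ^ 2)

/-- The objective as a function on `Joint d`. -/
def jointObjective (u : Joint d) : ℝ := P.objective u.fst u.snd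

/-- The objective for a single context `x`; the objective is its mean over the contexts. -/
def contextObjective (x : P.𝒳) (u : Joint d) : ℝ :=
  softMean P.η (fun ζ => P.expo x ζ u) + P.εx * u.snd

/-- The stochastic gradient `(v, w)` for the context `x` and the family `ω` of points of `𝒳`. For
the family `id` of all points it is the exact gradient of the objective for the context `x`. -/
def batchGrad {ι : Type*} [Fintype ι] (x : P.𝒳) (ω : ι → P.𝒳) (u : Joint d) : Joint d :=
  Finset.univ.centerMass (fun j => Real.exp (P.η * P.expo x (ω j) u))
    (fun j => P.score x (ω j) u) + WithLp.toLp 2 (0, P.εx)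

/-- The gradient of the objective. -/
def gradObjective (u : Joint d) : Joint d :=
  ∑ x, (P.ctx x).toReal • P.batchGrad x id u

theorem nonempty_contexts : Nonempty P.𝒳 :=
  P.ctx.support_nonempty.to_subtype.map Subtype.val

theorem jointObjective_eq_expect (u : Joint d) :
    P.jointObjective u = expect P.ctx fun x => P.contextObjective x u := by
  simp only [contextObjective]
  rw [expect_add (Set.toFinite _), expect_const (Set.toFinite _), expect_fintype,
    jointObjective, objective]
  simp only [softMean, expo, g, Fintype.card_coe]

theorem inner_gradObjective (u v : Joint d) :
    ⟪P.gradObjective u, v⟫ = expect P.ctx fun x => ⟪P.batchGrad x id u, v⟫ := by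
  rw [gradObjective, sum_inner, expect_fintype]
  simp only [real_inner_smul_left]

theorem toLp_update {m : ℕ} (γ : ℝ) (u : EuclideanSpace ℝ (Fin d) × ℝ) (x : P.𝒳)
    (ω : Fin m → P.𝒳) :
    WithLp.toLp 2 (P.update γ u x ω) =
      P.projFeas (WithLp.toLp 2 u - γ • P.batchGrad x ω (WithLp.toLp 2 u)) := by
  have hfst : (P.batchGrad x ω (WithLp.toLp 2 u)).fst = P.gradθ x ω u.1 u.2 := by
    rw [← WithLp.fstL_apply 2 ℝ, batchGrad, map_add, map_centerMass]
    exact add_zero _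
  have hsnd : (P.batchGrad x ω (WithLp.toLp 2 u)).snd = P.gradlam x ω u.1 u.2 := by
    rw [← WithLp.sndL_apply 2 ℝ, batchGrad, map_add, map_centerMass]
    simp [Finset.centerMass, score, expo, g, gradlam, div_eq_inv_mul]
  simp only [projFeas, update, WithLp.sub_fst, WithLp.sub_snd, WithLp.smul_fst, WithLp.smul_snd,
    WithLp.toLp_fst, WithLp.toLp_snd, hfst, hsnd, smul_eq_mul]

theorem hasGradientAt_expo {ζ : P.𝒳} {u : Joint d}
    (h : DifferentiableAt ℝ (fun θ => P.lhat θ ζ) u.fst) (x : P.𝒳) :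
    HasGradientAt (P.expo x ζ) (P.score x ζ u) u := by
  have hsnd : HasGradientAt (fun lam : ℝ => lam * -‖(x : EuclideanSpace ℝ (Fin q)) - ζ‖ ^ 2)
      (-‖(x : EuclideanSpace ℝ (Fin q)) - ζ‖ ^ 2) u.snd :=
    (hasDerivAt_mul_const _).hasGradientAt'
  have hsum := hasGradientAt_fst_add_snd (v := P.score x ζ u) h.hasGradientAt hsnd
  simp only [mul_neg, ← sub_eq_add_neg] at hsum
  exact hsum

theorem hasGradientAt_contextObjective (hη : P.η ≠ 0) {u : Joint d}
    (h : ∀ ζ, DifferentiableAt ℝ (fun θ => P.lhat θ ζ) u.fst) (x : P.𝒳) :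
    HasGradientAt (P.contextObjective x) (P.batchGrad x id u) u := by
  have := P.nonempty_contexts
  have hradius := hasGradientAt_fst_add_snd (u := u) (v := WithLp.toLp 2 (0, P.εx))
    (hasGradientAt_const u.fst 0) (hasDerivAt_const_mul P.εx).hasGradientAt'
  simp only [zero_add] at hradius
  exact hasGradientAt_add (hasGradientAt_softMean hη fun ζ => P.hasGradientAt_expo (h ζ) x) hradius

theorem hasGradientAt_jointObjective (hη : P.η ≠ 0) {u : Joint d}
    (h : ∀ ζ, DifferentiableAt ℝ (fun θ => P.lhat θ ζ) u.fst) :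
    HasGradientAt P.jointObjective (P.gradObjective u) u := by
  have hsum := HasFDerivAt.fun_sum fun x (_ : x ∈ Finset.univ) =>
    (P.hasGradientAt_contextObjective hη h x).hasFDerivAt.const_mul (P.ctx x).toReal
  rw [hasGradientAt_iff_hasFDerivAt, funext P.jointObjective_eq_expect]
  simp only [expect_fintype]
  refine hsum.congr_fderiv ?_
  simp only [gradObjective, map_sum, map_smul]

theorem gradMapSq_eq (hη : P.η ≠ 0) {u : EuclideanSpace ℝ (Fin d) × ℝ}
    (h : ∀ ζ, DifferentiableAt ℝ (fun θ => P.lhat θ ζ) u.1) (r : ℝ) :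
    P.gradMapSq r u = ‖r⁻¹ • ((WithLp.toLp 2 u : Joint d) -
      P.projFeas (WithLp.toLp 2 u - r • P.gradObjective (WithLp.toLp 2 u)))‖ ^ 2 := by
  have hgrad := P.hasGradientAt_jointObjective hη (u := WithLp.toLp 2 u) h
  have hfst : gradient (fun θ => P.objective θ u.2) u.1 =
      (P.gradObjective (WithLp.toLp 2 u)).fst :=
    (hasGradientAt_partial_fst hgrad).gradient
  have hsnd : deriv (fun lam => P.objective u.1 lam) u.2 =
      (P.gradObjective (WithLp.toLp 2 u)).snd :=
    (hasGradientAt_partial_snd hgrad).hasDerivAt'.deriv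
  rw [WithLp.prod_norm_sq_eq_of_L2, gradMapSq, hfst, hsnd]
  simp only [projFeas, WithLp.smul_fst, WithLp.smul_snd, WithLp.sub_fst, WithLp.sub_snd,
    WithLp.toLp_fst, WithLp.toLp_snd, smul_eq_mul, Real.norm_eq_abs, sq_abs]

theorem weaklyConvexOn_jointObjective (hη : 0 < P.η) {ρ : ℝ} {S : Set (Joint d)}
    (h : ∀ x ζ, WeaklyConvexOn ρ (P.expo x ζ) (P.score x ζ) S) :
    WeaklyConvexOn ρ P.jointObjective P.gradObjective S := by
  have := P.nonempty_contexts
  intro u hu v hv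
  have hmean : expect P.ctx (fun x => P.contextObjective x u + ⟪P.batchGrad x id u, v - u⟫ +
      -(ρ * ‖v - u‖ ^ 2)) ≤ expect P.ctx fun x => P.contextObjective x v := by
    refine expect_mono (Set.toFinite _) fun x _ => ?_
    have hsoft := weaklyConvexOn_softMean hη (h x) u hu v hv
    have hradius : ⟪(WithLp.toLp 2 (0, P.εx) : Joint d), v - u⟫ = P.εx * (v.snd - u.snd) := by
      simp [WithLp.prod_inner_apply, mul_comm]
    rw [batchGrad, inner_add_left, hradius]
    simp only [contextObjective, id_eq]
    linarith
  rw [expect_add (Set.toFinite _), expect_add (Set.toFinite _), expect_const (Set.toFinite _),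
    ← jointObjective_eq_expect, ← jointObjective_eq_expect, ← inner_gradObjective] at hmean
  linarith

theorem abs_lhat_le {θ : EuclideanSpace ℝ (Fin d)} {ζ : P.𝒳}
    (h : P.pol θ ζ ∈ stdSimplex ℝ (Fin k)) : |P.lhat θ ζ| ≤ ∑ a, |P.mhat ζ a| := by
  refine (Finset.abs_sum_le_sum_abs _ _).trans (Finset.sum_le_sum fun a _ => ?_)
  rw [abs_mul, abs_of_nonneg (h.1 a)]
  exact mul_le_of_le_one_left (abs_nonneg _) (mem_Icc_of_mem_stdSimplex h a).2

theorem le_jointObjective (hη : 0 < P.η) {u : Joint d} {C : ℝ} (h : ∀ x, C ≤ P.lhat u.fst x) :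
    C - Real.log P.𝒳.card / P.η + P.εx * u.snd ≤ P.jointObjective u := by
  have := P.nonempty_contexts
  rw [jointObjective_eq_expect]
  refine const_le_expect (Set.toFinite _) fun x _ => ?_
  have hself := sub_le_softMean hη (fun ζ => P.expo x ζ u) x
  simp only [expo, sub_self, norm_zero, Fintype.card_coe] at hself
  simp only [contextObjective, expo]
  linarith [h x]

end Problem

namespace Problem

variable {d q k : ℕ} {P : Problem d q k}

/-- The standing assumptions on the problem, with a smoothness constant `L` of the costs, a bound
`G` of the scores, and a constant `F₀` from which the objective grows at least linearly in `λ`. -/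
structure Regular (P : Problem d q k) (L G F₀ : ℝ) : Prop where
  η_pos : 0 < P.η
  εx_pos : 0 < P.εx
  isCompact : IsCompact P.Θ
  convex : Convex ℝ P.Θ
  nonempty : P.Θ.Nonempty
  L_nonneg : 0 ≤ L
  smooth : ∀ ζ, SmoothOn L (fun θ => P.lhat θ ζ) P.Θ
  norm_score_le : ∀ x ζ, ∀ u ∈ P.feas, ‖P.score x ζ u‖ ≤ G
  le_objective : ∀ u ∈ P.feas, F₀ + P.εx * u.snd ≤ P.jointObjective u

theorem exists_norm_score_le (hcompact : IsCompact P.Θ) {B : ℝ}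
    (hdiam : ∀ x ∈ P.𝒳, ∀ y ∈ P.𝒳, ‖x - y‖ ≤ B) {L : ℝ}
    (hsmooth : ∀ ζ, SmoothOn L (fun θ => P.lhat θ ζ) P.Θ) :
    ∃ G, ∀ x ζ, ∀ u ∈ P.feas, ‖P.score x ζ u‖ ≤ G := by
  choose C hC using fun ζ => exists_norm_gradient_le_of_smoothOn (hsmooth ζ) hcompact
  obtain ⟨A, hA⟩ := Finite.exists_le C
  refine ⟨A + B ^ 2, fun x ζ u hu => (norm_le_norm_fst_add_norm_snd _).trans (add_le_add ?_ ?_)⟩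
  · exact (hC ζ _ hu.1).trans (hA ζ)
  · have hdist := hdiam x x.2 ζ ζ.2
    rw [score, WithLp.toLp_snd, norm_neg, norm_pow, norm_norm]
    gcongr

theorem exists_regular (hη : 0 < P.η) (hε : 0 < P.εx) (hcompact : IsCompact P.Θ)
    (hconvex : Convex ℝ P.Θ) (hne : P.Θ.Nonempty)
    (hpol : ∀ θ ∈ P.Θ, ∀ ζ, P.pol θ ζ ∈ stdSimplex ℝ (Fin k)) {B : ℝ}
    (hdiam : ∀ x ∈ P.𝒳, ∀ y ∈ P.𝒳, ‖x - y‖ ≤ B) {L : ℝ}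
    (hsmooth : ∀ ζ, SmoothOn L (fun θ => P.lhat θ ζ) P.Θ) :
    ∃ L G F₀, P.Regular L G F₀ := by
  obtain ⟨G, hG⟩ := exists_norm_score_le hcompact hdiam hsmooth
  obtain ⟨M, hM⟩ := Finite.exists_le fun ζ => ∑ a, |P.mhat ζ a|
  refine ⟨max L 0, G, -M - Real.log P.𝒳.card / P.η, hη, hε, hcompact, hconvex, hne,
    le_max_right L 0, fun ζ => ⟨(hsmooth ζ).1, fun θ hθ θ' hθ' => ?_⟩, hG,
    fun u hu => P.le_jointObjective hη fun ζ => ?_⟩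
  · exact ((hsmooth ζ).2 θ hθ θ' hθ').trans (by gcongr; exact le_max_left L 0)
  · exact neg_le_of_abs_le ((P.abs_lhat_le (hpol u.fst hu.1 ζ)).trans (hM ζ))

namespace Regular

variable {L G F₀ : ℝ} (hP : P.Regular L G F₀)
include hP

theorem isProjOnto_projFeas : IsProjOnto P.feas P.projFeas :=
  (isProjOnto_proj hP.nonempty hP.isCompact.isClosed hP.convex).prod (isProjOnto_Ici 0)

theorem feas_nonempty : P.feas.Nonempty :=
  ⟨_, hP.isProjOnto_projFeas.mem 0⟩

theorem G_nonneg : 0 ≤ G :=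
  let ⟨u, hu⟩ := hP.feas_nonempty
  let ⟨x⟩ := P.nonempty_contexts
  (norm_nonneg _).trans (hP.norm_score_le x x u hu)

theorem convex_feas : Convex ℝ P.feas :=
  (hP.convex.linear_preimage (WithLp.fstL 2 ℝ _ _).toLinearMap).inter
    ((convex_Ici 0).linear_preimage (WithLp.sndL 2 ℝ _ _).toLinearMap)

theorem isClosed_feas : IsClosed P.feas :=
  (hP.isCompact.isClosed.preimage (WithLp.fstL 2 ℝ _ _).continuous).inter
    (isClosed_Ici.preimage (WithLp.sndL 2 ℝ _ _).continuous)

theorem exists_norm_le_add_snd : ∃ D, ∀ u ∈ P.feas, ‖u‖ ≤ D + u.snd := by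
  obtain ⟨D, hD⟩ := hP.isCompact.isBounded.exists_norm_le
  refine ⟨D, fun u hu => (norm_le_norm_fst_add_norm_snd u).trans ?_⟩
  rw [Real.norm_of_nonneg hu.2]
  gcongr
  exact hD _ hu.1

theorem hasGradientAt_expo (x ζ : P.𝒳) {u : Joint d} (hu : u ∈ P.feas) :
    HasGradientAt (P.expo x ζ) (P.score x ζ u) u :=
  P.hasGradientAt_expo ((hP.smooth ζ).1 _ hu.1) x

theorem hasGradientAt_jointObjective {u : Joint d} (hu : u ∈ P.feas) :
    HasGradientAt P.jointObjective (P.gradObjective u) u :=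
  P.hasGradientAt_jointObjective hP.η_pos.ne' fun ζ => (hP.smooth ζ).1 _ hu.1

theorem norm_score_sub_le (x ζ : P.𝒳) {u v : Joint d} (hu : u ∈ P.feas) (hv : v ∈ P.feas) :
    ‖P.score x ζ u - P.score x ζ v‖ ≤ L * ‖u - v‖ := by
  refine (norm_le_norm_fst_add_norm_snd _).trans ?_
  simp only [score, WithLp.sub_fst, WithLp.sub_snd, WithLp.toLp_fst, WithLp.toLp_snd, sub_self,
    norm_zero, add_zero]
  refine ((hP.smooth ζ).2 u.fst hu.1 v.fst hv.1).trans ?_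
  gcongr
  · exact hP.L_nonneg
  · exact WithLp.norm_fst_le _ (u - v)

theorem weaklyConvexOn_jointObjective : WeaklyConvexOn L P.jointObjective P.gradObjective P.feas :=
  P.weaklyConvexOn_jointObjective hP.η_pos fun x ζ =>
    weaklyConvexOn_of_lipschitz_gradient hP.convex_feas hP.L_nonneg
      (fun _ hu => hP.hasGradientAt_expo x ζ hu) fun _ hu _ hv => hP.norm_score_sub_le x ζ hu hv

theorem weaklyConvexOn_zero_jointObjective (hconv : ∀ ζ, ConvexOn ℝ P.Θ fun θ => P.lhat θ ζ) :
    WeaklyConvexOn 0 P.jointObjective P.gradObjective P.feas := by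
  refine P.weaklyConvexOn_jointObjective hP.η_pos fun x ζ =>
    weaklyConvexOn_zero_of_convexOn ?_ fun _ hu => hP.hasGradientAt_expo x ζ hu
  have hlin := (-‖(x : EuclideanSpace ℝ (Fin q)) - ζ‖ ^ 2 •
    (WithLp.sndL 2 ℝ (EuclideanSpace ℝ (Fin d)) ℝ).toLinearMap).convexOn hP.convex_feas
  have hcost := ((hconv ζ).comp_linearMap (WithLp.fstL 2 ℝ _ ℝ).toLinearMap).subset
    (fun _ hu => hu.1) hP.convex_feas
  refine (hcost.add hlin).congr fun u _ => ?_
  simp [expo, mul_comm, sub_eq_add_neg]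

theorem norm_gradObjective_sub_le {u v : Joint d} (hu : u ∈ P.feas) (hv : v ∈ P.feas) :
    ‖P.gradObjective u - P.gradObjective v‖ ≤ (4 * P.η * G ^ 2 + L) * ‖u - v‖ := by
  have := P.nonempty_contexts
  have hexpo : ∀ x ζ, |P.η * P.expo x ζ u - P.η * P.expo x ζ v| ≤ P.η * (G * ‖u - v‖) := by
    intro x ζ
    rw [← mul_sub, abs_mul, abs_of_pos hP.η_pos]
    refine mul_le_mul_of_nonneg_left ?_ hP.η_pos.le
    exact abs_sub_le_of_norm_gradient_le hP.convex_feas (fun _ hw => hP.hasGradientAt_expo x ζ hw)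
      (hP.norm_score_le x ζ) hv hu
  have hcontext : ∀ x, ‖P.batchGrad x id u - P.batchGrad x id v‖ ≤
      (4 * P.η * G ^ 2 + L) * ‖u - v‖ := by
    intro x
    rw [batchGrad, batchGrad, add_sub_add_right_eq_sub]
    refine (norm_centerMass_exp_sub_le (hexpo x) (fun ζ => hP.norm_score_le x ζ u hu)
      fun ζ => hP.norm_score_sub_le x ζ hu hv).trans_eq ?_
    ring
  have hctx : ∑ x, (P.ctx x).toReal = 1 := sum_toReal_eq_one (s := Finset.univ) (by simp)
  calc ‖P.gradObjective u - P.gradObjective v‖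
      = ‖∑ x, (P.ctx x).toReal • (P.batchGrad x id u - P.batchGrad x id v)‖ := by
        simp only [gradObjective, smul_sub, Finset.sum_sub_distrib]
    _ ≤ ∑ x, (P.ctx x).toReal * ((4 * P.η * G ^ 2 + L) * ‖u - v‖) := by
        refine norm_sum_le_of_le _ fun x _ => ?_
        rw [norm_smul, Real.norm_of_nonneg ENNReal.toReal_nonneg]
        gcongr
        exact hcontext x
    _ = (4 * P.η * G ^ 2 + L) * ‖u - v‖ := by rw [← Finset.sum_mul, hctx, one_mul]

theorem exists_isProx {κ : ℝ} (hκ : 0 ≤ κ) (u : Joint d) :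
    ∃ y, IsProx P.jointObjective P.feas κ u y := by
  obtain ⟨D, hD⟩ := hP.exists_norm_le_add_snd
  obtain ⟨v, hv⟩ := hP.feas_nonempty
  have hcont : ContinuousOn (fun z => P.jointObjective z + κ * ‖z - u‖ ^ 2) P.feas :=
    ContinuousOn.add (fun z hz => (hP.hasGradientAt_jointObjective hz).continuousAt
      |>.continuousWithinAt) (by fun_prop)
  have hlim : Filter.Tendsto (fun z : Joint d => F₀ + P.εx * (‖z‖ - D)) (Filter.cocompact _)
      Filter.atTop :=
    Filter.tendsto_atTop_add_const_left _ _ ((Filter.tendsto_atTop_add_const_right _ _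
      (tendsto_norm_cocompact_atTop)).const_mul_atTop hP.εx_pos)
  have hfar : ∀ᶠ z in Filter.cocompact (Joint d) ⊓ Filter.principal P.feas,
      P.jointObjective v + κ * ‖v - u‖ ^ 2 ≤ P.jointObjective z + κ * ‖z - u‖ ^ 2 := by
    rw [Filter.eventually_inf_principal]
    filter_upwards [hlim.eventually_ge_atTop (P.jointObjective v + κ * ‖v - u‖ ^ 2)]
      with z hlarge hz
    have hgrowth := mul_le_mul_of_nonneg_left (sub_le_iff_le_add'.2 (hD z hz)) hP.εx_pos.le
    linarith [hP.le_objective z hz, mul_nonneg hκ (sq_nonneg ‖z - u‖)]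
  obtain ⟨y, hy, hmin⟩ := hcont.exists_isMinOn' hP.isClosed_feas hv hfar
  exact ⟨y, hy, hmin⟩

end Regular

end Problem

namespace Problem

variable {d q k : ℕ} {P : Problem d q k}

theorem expect_step (γ : ℝ) (m : ℕ) (u : EuclideanSpace ℝ (Fin d) × ℝ)
    (f : EuclideanSpace ℝ (Fin d) × ℝ → ℝ) :
    expect (P.step γ m u) f =
      expect P.ctx fun x => 𝔼 ω : Fin m → P.𝒳, f (P.update γ u x ω) := by
  have := P.nonempty_contexts
  rw [step, expect_bind (Set.toFinite _) fun x _ => ?_]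
  · simp only [expect_map (Set.toFinite _), expect_uniformOfFintype]
  · rw [PMF.support_map]
    exact (Set.toFinite _).image _

theorem expect_output (T : ℕ) [NeZero T] (γ : ℕ → ℝ) (m : ℕ → ℕ)
    (u₀ : EuclideanSpace ℝ (Fin d) × ℝ) (f : EuclideanSpace ℝ (Fin d) × ℝ → ℝ) :
    expect (P.output T γ m u₀) f = (∑ t ∈ Finset.range T, expect (P.iterate γ m u₀ t) f) / T := by
  rw [output, expect_bind (Set.toFinite _) fun (t : Fin T) _ => P.finite_support_iterate γ m u₀ t,
    expect_uniformOfFintype, Fintype.expect_eq_sum_div_card, Fintype.card_fin,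
    Fin.sum_univ_eq_sum_range fun t => expect (P.iterate γ m u₀ t) f]

section Descent

variable {S : Set (EuclideanSpace ℝ (Fin d) × ℝ)} {u₀ : EuclideanSpace ℝ (Fin d) × ℝ}

theorem mem_of_mem_support_step {γ : ℝ} {m : ℕ} {u w : EuclideanSpace ℝ (Fin d) × ℝ}
    (hS : ∀ x (ω : Fin m → P.𝒳), P.update γ u x ω ∈ S) (hw : w ∈ (P.step γ m u).support) :
    w ∈ S := by
  rw [step, PMF.support_bind] at hw
  obtain ⟨x, -, hx⟩ := Set.mem_iUnion₂.1 hw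
  rw [PMF.support_map] at hx
  obtain ⟨ω, -, rfl⟩ := hx
  exact hS x ω

variable {γ : ℕ → ℝ} {m : ℕ → ℕ} (hu₀ : u₀ ∈ S)
  (hS : ∀ t, ∀ u ∈ S, ∀ x (ω : Fin (m t) → P.𝒳), P.update (γ t) u x ω ∈ S)
include hu₀ hS

theorem support_iterate_subset (t : ℕ) : (P.iterate γ m u₀ t).support ⊆ S := by
  induction t with
  | zero =>
    rw [iterate, PMF.support_pure]
    exact Set.singleton_subset_iff.2 hu₀
  | succ t ih =>
    rw [iterate, PMF.support_bind]
    exact Set.iUnion₂_subset fun v hv w hw => mem_of_mem_support_step (hS t v (ih hv)) hw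

theorem support_output_subset {T : ℕ} [NeZero T] : (P.output T γ m u₀).support ⊆ S := by
  rw [output, PMF.support_bind]
  exact Set.iUnion₂_subset fun t _ => support_iterate_subset hu₀ hS t

variable {V R : EuclideanSpace ℝ (Fin d) × ℝ → ℝ} {e : ℝ} {T : ℕ}
  (hstep : ∀ t < T, ∀ u ∈ S, expect (P.step (γ t) (m t) u) V ≤ V u - R u + e)
include hstep

theorem expect_iterate_succ_le {t : ℕ} (ht : t < T) :
    expect (P.iterate γ m u₀ (t + 1)) V ≤
      expect (P.iterate γ m u₀ t) V - expect (P.iterate γ m u₀ t) R + e := by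
  have hfin := P.finite_support_iterate γ m u₀ t
  calc expect (P.iterate γ m u₀ (t + 1)) V
      = expect (P.iterate γ m u₀ t) fun u => expect (P.step (γ t) (m t) u) V := by
        rw [iterate, expect_bind hfin fun u _ => P.finite_support_step _ _ u]
    _ ≤ expect (P.iterate γ m u₀ t) fun u => V u + -1 * R u + e := by
        refine expect_mono hfin fun u hu => ?_
        linarith [hstep t ht u (support_iterate_subset hu₀ hS t hu)]
    _ = expect (P.iterate γ m u₀ t) V - expect (P.iterate γ m u₀ t) R + e := by
        rw [expect_add hfin, expect_add hfin, expect_const_mul, expect_const hfin]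
        ring

theorem expect_iterate_add_sum_le {t : ℕ} (ht : t ≤ T) :
    expect (P.iterate γ m u₀ t) V + ∑ s ∈ Finset.range t, expect (P.iterate γ m u₀ s) R ≤
      V u₀ + t * e := by
  induction t with
  | zero => simp [iterate, expect_pure]
  | succ t ih =>
    rw [Finset.sum_range_succ]
    push_cast
    linarith [ih (Nat.le_of_succ_le ht), expect_iterate_succ_le hu₀ hS hstep ht]

theorem expect_output_le_of_descent [NeZero T] {V₀ : ℝ} (hV : ∀ u ∈ S, V₀ ≤ V u) :
    expect (P.output T γ m u₀) R ≤ (V u₀ - V₀) / T + e := by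
  have hT : (0 : ℝ) < T := Nat.cast_pos.2 (Nat.pos_of_neZero T)
  have hlow := const_le_expect (P.finite_support_iterate γ m u₀ T) fun u hu =>
    hV u (support_iterate_subset hu₀ hS T hu)
  rw [expect_output, div_le_iff₀ hT, add_mul, div_mul_cancel₀ _ hT.ne']
  linarith [expect_iterate_add_sum_le hu₀ hS hstep le_rfl]

end Descent

theorem expect_output_le_of_sqrt_step {S : Set (EuclideanSpace ℝ (Fin d) × ℝ)}
    {u₀ : EuclideanSpace ℝ (Fin d) × ℝ} (hu₀ : u₀ ∈ S) {c : ℝ} (hc : 0 < c) {T : ℕ} [NeZero T]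
    {m : ℕ → ℕ} (hS : ∀ t, ∀ u ∈ S, ∀ x (ω : Fin (m t) → P.𝒳), P.update (c / √T) u x ω ∈ S)
    {V R : EuclideanSpace ℝ (Fin d) × ℝ → ℝ} {V₀ e σ : ℝ} (hV : ∀ u ∈ S, V₀ ≤ V u)
    (hstep : ∀ t < T, ∀ u ∈ S, expect (P.step (c / √T) (m t) u) V ≤
      V u - c / √T * R u + (c / √T * e + (c / √T) ^ 2 * σ)) :
    expect (P.output T (fun _ => c / √T) m u₀) R ≤ ((V u₀ - V₀) / c + c * σ) / √T + e := by
  have hT : (0 : ℝ) < T := Nat.cast_pos.2 (Nat.pos_of_neZero T)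
  have hsqrt : 0 < √(T : ℝ) := Real.sqrt_pos.2 hT
  have hdescent := expect_output_le_of_descent (γ := fun _ => c / √(T : ℝ)) hu₀ hS hstep hV
  rw [expect_const_mul] at hdescent
  refine le_of_mul_le_mul_left (hdescent.trans_eq ?_) (div_pos hc hsqrt)
  rw [← Real.sq_sqrt hT.le]
  simp only [Real.sqrt_sq hsqrt.le]
  field_simp
  ring

variable (P) in
theorem inner_batchGrad {ι : Type*} [Fintype ι] (x : P.𝒳) (ω : ι → P.𝒳) (u h : Joint d) :
    ⟪P.batchGrad x ω u, h⟫ = Finset.univ.centerMass (fun j => Real.exp (P.η * P.expo x (ω j) u))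
      (fun j => ⟪P.score x (ω j) u, h⟫) + ⟪(WithLp.toLp 2 (0, P.εx) : Joint d), h⟫ := by
  rw [batchGrad, inner_add_left]
  congr 1
  exact map_centerMass ((innerSL ℝ).flip h) _ _

namespace Regular

variable {L G F₀ : ℝ} (hP : P.Regular L G F₀)
include hP

theorem toLp_update_mem {m : ℕ} (γ : ℝ) (u : EuclideanSpace ℝ (Fin d) × ℝ) (x : P.𝒳)
    (ω : Fin m → P.𝒳) : WithLp.toLp 2 (P.update γ u x ω) ∈ P.feas := by
  rw [toLp_update]
  exact hP.isProjOnto_projFeas.mem _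

theorem norm_batchGrad_le {ι : Type*} [Fintype ι] [Nonempty ι] (x : P.𝒳) (ω : ι → P.𝒳)
    {u : Joint d} (hu : u ∈ P.feas) : ‖P.batchGrad x ω u‖ ≤ G + P.εx := by
  have hradius : ‖(WithLp.toLp 2 (0, P.εx) : Joint d)‖ ≤ P.εx := by
    refine (norm_le_norm_fst_add_norm_snd _).trans_eq ?_
    simp [abs_of_pos hP.εx_pos]
  exact (norm_add_le _ _).trans (add_le_add (norm_centerMass_le (fun _ => Real.exp_pos _)
    fun j => hP.norm_score_le x (ω j) u hu) hradius)

theorem abs_expect_inner_batchGrad_sub_le (x : P.𝒳) {u : Joint d} (hu : u ∈ P.feas) (h : Joint d)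
    {m : ℕ} (hm : 0 < m) :
    |(𝔼 ω : Fin m → P.𝒳, ⟪P.batchGrad x ω u, h⟫) - ⟪P.batchGrad x id u, h⟫| ≤
      4 * G * P.𝒳.card / m * ‖h‖ := by
  have := P.nonempty_contexts
  have := Fin.pos_iff_nonempty.1 hm
  have hbound : ∀ ζ, |⟪P.score x ζ u, h⟫| ≤ G * ‖h‖ := fun ζ =>
    (abs_real_inner_le_norm _ _).trans (by gcongr; exact hP.norm_score_le x ζ u hu)
  have hbias := abs_expect_batch_centerMass_sub_le
    (g := fun ζ => Real.exp (P.η * P.expo x ζ u)) (fun _ => Real.exp_pos _) hbound hm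
  simp only [P.inner_batchGrad, Finset.expect_add_distrib, Fintype.expect_const, id_eq,
    add_sub_add_right_eq_sub]
  refine hbias.trans_eq ?_
  rw [Fintype.card_coe]
  ring

theorem expect_norm_update_sub_sq_le {γ : ℝ} (hγ : 0 ≤ γ) (x : P.𝒳) {m : ℕ} (hm : 0 < m) {b : ℝ}
    (hb : 4 * G * P.𝒳.card / m ≤ b) {u : EuclideanSpace ℝ (Fin d) × ℝ}
    (hu : WithLp.toLp 2 u ∈ P.feas) {z : Joint d} (hz : z ∈ P.feas) :
    (𝔼 ω : Fin m → P.𝒳, ‖WithLp.toLp 2 (P.update γ u x ω) - z‖ ^ 2) ≤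
      ‖WithLp.toLp 2 u - z‖ ^ 2
        + 2 * γ * (b * ‖WithLp.toLp 2 u - z‖) + γ ^ 2 * (G + P.εx) ^ 2
        + -(2 * γ) * ⟪P.batchGrad x id (WithLp.toLp 2 u), WithLp.toLp 2 u - z⟫ := by
  have := P.nonempty_contexts
  have := Fin.pos_iff_nonempty.1 hm
  let v : Joint d := WithLp.toLp 2 u
  have hbias : ⟪P.batchGrad x id v, v - z⟫ - b * ‖v - z‖ ≤
      𝔼 ω : Fin m → P.𝒳, ⟪P.batchGrad x ω v, v - z⟫ := by
    have habs := (abs_le.1 (hP.abs_expect_inner_batchGrad_sub_le x hu (v - z) hm)).1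
    linarith [mul_le_mul_of_nonneg_right hb (norm_nonneg (v - z))]
  calc (𝔼 ω : Fin m → P.𝒳, ‖WithLp.toLp 2 (P.update γ u x ω) - z‖ ^ 2)
      ≤ 𝔼 ω : Fin m → P.𝒳, (‖v - z‖ ^ 2 + γ ^ 2 * (G + P.εx) ^ 2
          - 2 * γ * ⟪P.batchGrad x ω v, v - z⟫) := by
        refine Finset.expect_le_expect fun ω _ => ?_
        rw [toLp_update]
        refine (hP.isProjOnto_projFeas.norm_step_sq_le hz v _ γ).trans ?_
        rw [sub_add_eq_add_sub]
        gcongr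
        exact hP.norm_batchGrad_le x ω hu
    _ = ‖v - z‖ ^ 2 + γ ^ 2 * (G + P.εx) ^ 2
          - 2 * γ * 𝔼 ω : Fin m → P.𝒳, ⟪P.batchGrad x ω v, v - z⟫ := by
        rw [Finset.expect_sub_distrib, Fintype.expect_const, ← Finset.mul_expect]
    _ ≤ ‖v - z‖ ^ 2 + 2 * γ * (b * ‖v - z‖) + γ ^ 2 * (G + P.εx) ^ 2
          + -(2 * γ) * ⟪P.batchGrad x id v, v - z⟫ := by
        linarith [mul_le_mul_of_nonneg_left hbias (mul_nonneg zero_le_two hγ)]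

theorem expect_step_norm_sub_sq_le {γ : ℝ} (hγ : 0 ≤ γ) {m : ℕ} (hm : 0 < m) {b : ℝ}
    (hb : 4 * G * P.𝒳.card / m ≤ b) {u : EuclideanSpace ℝ (Fin d) × ℝ}
    (hu : WithLp.toLp 2 u ∈ P.feas) {z : Joint d} (hz : z ∈ P.feas) :
    expect (P.step γ m u) (fun w => ‖WithLp.toLp 2 w - z‖ ^ 2) ≤
      ‖WithLp.toLp 2 u - z‖ ^ 2
        + 2 * γ * (b * ‖WithLp.toLp 2 u - z‖) + γ ^ 2 * (G + P.εx) ^ 2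
        + -(2 * γ) * ⟪P.gradObjective (WithLp.toLp 2 u), WithLp.toLp 2 u - z⟫ := by
  rw [expect_step]
  refine (expect_mono (Set.toFinite _) fun x _ =>
    hP.expect_norm_update_sub_sq_le hγ x hm hb hu hz).trans_eq ?_
  rw [expect_add (Set.toFinite _), expect_const (Set.toFinite _), expect_const_mul,
    inner_gradObjective]

end Regular

end Problem

namespace Problem.Regular

variable {d q k : ℕ} {P : Problem d q k} {L G F₀ : ℝ} (hP : P.Regular L G F₀)
include hP

section Convex

variable (hconv : ∀ ζ, ConvexOn ℝ P.Θ fun θ => P.lhat θ ζ) {z : Joint d} (hz : z ∈ P.feas)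

theorem exists_isMinOn : ∃ z ∈ P.feas, IsMinOn P.jointObjective P.feas z := by
  obtain ⟨z, hz, hmin⟩ := hP.exists_isProx le_rfl 0
  exact ⟨z, hz, by simpa only [zero_mul, add_zero] using hmin⟩

include hz

theorem exists_norm_sub_le : ∃ E, 0 ≤ E ∧ ∀ u ∈ P.feas,
    ‖u - z‖ ≤ E + (P.jointObjective u - P.jointObjective z) / P.εx := by
  obtain ⟨D, hD⟩ := hP.exists_norm_le_add_snd
  have hbound : ∀ u ∈ P.feas, ‖u - z‖ ≤ (D + ‖z‖ + (P.jointObjective z - F₀) / P.εx) +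
      (P.jointObjective u - P.jointObjective z) / P.εx := by
    intro u hu
    have hsnd : u.snd ≤ (P.jointObjective u - F₀) / P.εx := by
      rw [le_div_iff₀ hP.εx_pos]
      linarith [hP.le_objective u hu]
    have hsplit : (P.jointObjective z - F₀) / P.εx +
        (P.jointObjective u - P.jointObjective z) / P.εx = (P.jointObjective u - F₀) / P.εx := by
      ring
    linarith [norm_sub_le u z, hD u hu]
  exact ⟨_, by simpa only [sub_self, norm_zero, zero_div, add_zero] using hbound z hz, hbound⟩

include hconv

theorem expect_step_norm_sub_sq_le_of_isMinOn (hmin : IsMinOn P.jointObjective P.feas z) {E : ℝ}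
    (hE : ∀ u ∈ P.feas, ‖u - z‖ ≤ E + (P.jointObjective u - P.jointObjective z) / P.εx)
    {γ : ℝ} (hγ : 0 ≤ γ) {m : ℕ} (hm : 0 < m) {b : ℝ} (hb : 4 * G * P.𝒳.card / m ≤ b)
    (hbε : 2 * b ≤ P.εx) {u : EuclideanSpace ℝ (Fin d) × ℝ} (hu : WithLp.toLp 2 u ∈ P.feas) :
    expect (P.step γ m u) (fun w => ‖WithLp.toLp 2 w - z‖ ^ 2) ≤
      ‖WithLp.toLp 2 u - z‖ ^ 2 - γ * (P.objective u.1 u.2 - P.jointObjective z)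
        + (γ * (2 * b * E) + γ ^ 2 * (G + P.εx) ^ 2) := by
  let gap := P.objective u.1 u.2 - P.jointObjective z
  have hgap : 0 ≤ gap := sub_nonneg.2 (hmin hu)
  have hb0 : 0 ≤ b := le_trans (by have := hP.G_nonneg; positivity) hb
  -- The feasible set is unbounded, but `‖u - z‖` exceeds `E` by at most a multiple of the gap,
  -- which half of the descent absorbs.
  have hbias : 2 * (b * ‖WithLp.toLp 2 u - z‖) ≤ 2 * b * E + gap := by
    calc 2 * (b * ‖WithLp.toLp 2 u - z‖) ≤ 2 * (b * (E + gap / P.εx)) := by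
          gcongr
          exact hE _ hu
      _ = 2 * b * E + 2 * b / P.εx * gap := by ring
      _ ≤ 2 * b * E + gap := by
          gcongr
          exact mul_le_of_le_one_left hgap ((div_le_one hP.εx_pos).2 hbε)
  have hconvex : gap ≤ ⟪P.gradObjective (WithLp.toLp 2 u), WithLp.toLp 2 u - z⟫ := by
    have hline := hP.weaklyConvexOn_zero_jointObjective hconv _ hu z hz
    rw [← neg_sub (WithLp.toLp 2 u) z, inner_neg_right] at hline
    change P.jointObjective (WithLp.toLp 2 u) - P.jointObjective z ≤ _
    linarith
  linarith [hP.expect_step_norm_sub_sq_le hγ hm hb hu hz, mul_le_mul_of_nonneg_left hbias hγ,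
    mul_le_mul_of_nonneg_left hconvex hγ]

theorem expect_output_objective_sub_le (hmin : IsMinOn P.jointObjective P.feas z) {E : ℝ}
    (hE : ∀ u ∈ P.feas, ‖u - z‖ ≤ E + (P.jointObjective u - P.jointObjective z) / P.εx)
    {u₀ : EuclideanSpace ℝ (Fin d) × ℝ} (hu₀ : WithLp.toLp 2 u₀ ∈ P.feas) {c : ℝ} (hc : 0 < c)
    {T : ℕ} [NeZero T] {m : ℕ → ℕ} (hm : ∀ t < T, 0 < m t) {b : ℝ}
    (hb : ∀ t < T, 4 * G * P.𝒳.card / m t ≤ b) (hbε : 2 * b ≤ P.εx) :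
    expect (P.output T (fun _ => c / √T) m u₀) (fun u => P.objective u.1 u.2)
        - P.jointObjective z ≤
      (‖WithLp.toLp 2 u₀ - z‖ ^ 2 / c + c * (G + P.εx) ^ 2) / √T + 2 * b * E := by
  have hrate := expect_output_le_of_sqrt_step (S := WithLp.toLp 2 ⁻¹' P.feas) (T := T) (m := m)
    (V := fun u => ‖WithLp.toLp 2 u - z‖ ^ 2) hu₀ hc (fun _ _ _ _ ω => hP.toLp_update_mem _ _ _ ω)
    (fun _ _ => sq_nonneg _) fun t ht _ hu => hP.expect_step_norm_sub_sq_le_of_isMinOn hconv hz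
      hmin hE (by positivity) (hm t ht) (hb t ht) hbε hu
  have hfin := P.finite_support_output T (fun _ => c / √T) m u₀
  simp only [sub_eq_add_neg, expect_add hfin, expect_const hfin] at hrate ⊢
  simpa only [neg_zero, add_zero] using hrate

omit hz in
theorem exists_expect_output_objective_sub_le {u₀ : EuclideanSpace ℝ (Fin d) × ℝ}
    (hu₀ : WithLp.toLp 2 u₀ ∈ P.feas) {c : ℝ} (hc : 0 < c) :
    ∃ K E, 0 ≤ K ∧ 0 ≤ E ∧ ∀ (T : ℕ) [NeZero T] (m : ℕ → ℕ) (b : ℝ), (∀ t < T, 0 < m t) →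
      (∀ t < T, 4 * G * P.𝒳.card / m t ≤ b) → 2 * b ≤ P.εx → ∀ u ∈ P.feas,
      expect (P.output T (fun _ => c / √T) m u₀) (fun u => P.objective u.1 u.2)
        - P.jointObjective u ≤ K / √T + 2 * b * E := by
  obtain ⟨z, hz, hmin⟩ := hP.exists_isMinOn
  obtain ⟨E, hE0, hE⟩ := hP.exists_norm_sub_le hz
  refine ⟨_, E, ?_, hE0, fun T _ m b hm hb hbε u hu => (sub_le_sub_left (hmin hu) _).trans
    (hP.expect_output_objective_sub_le hconv hz hmin hE hu₀ hc hm hb hbε)⟩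
  positivity

end Convex

end Problem.Regular

namespace Problem.Regular

variable {d q k : ℕ} {P : Problem d q k} {L G F₀ : ℝ} (hP : P.Regular L G F₀)
include hP

theorem le_jointObjective {u : Joint d} (hu : u ∈ P.feas) : F₀ ≤ P.jointObjective u :=
  (le_add_of_nonneg_right (mul_nonneg hP.εx_pos.le hu.2)).trans (hP.le_objective u hu)

variable {y : Joint d → Joint d} (hy : ∀ u, IsProx P.jointObjective P.feas (L + 1) u (y u))
include hy

theorem expect_step_envelope_le {γ : ℝ} (hγ : 0 ≤ γ) {m : ℕ} (hm : 0 < m) {b : ℝ}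
    (hb : 4 * G * P.𝒳.card / m ≤ b) {u : EuclideanSpace ℝ (Fin d) × ℝ}
    (hu : WithLp.toLp 2 u ∈ P.feas) :
    expect (P.step γ m u) (fun w => P.jointObjective (y (WithLp.toLp 2 w)) +
        (L + 1) * ‖y (WithLp.toLp 2 w) - WithLp.toLp 2 w‖ ^ 2) ≤
      P.jointObjective (y (WithLp.toLp 2 u)) +
          (L + 1) * ‖y (WithLp.toLp 2 u) - WithLp.toLp 2 u‖ ^ 2
        - γ * ((L + 1) * ‖y (WithLp.toLp 2 u) - WithLp.toLp 2 u‖ ^ 2)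
        + (γ * ((L + 1) * b ^ 2) + γ ^ 2 * ((L + 1) * (G + P.εx) ^ 2)) := by
  let v : Joint d := WithLp.toLp 2 u
  have hfin := P.finite_support_step γ m u
  have hL := hP.L_nonneg
  have hstep : expect (P.step γ m u) (fun w => ‖WithLp.toLp 2 w - y v‖ ^ 2) ≤
      ‖y v - v‖ ^ 2 - γ * ‖y v - v‖ ^ 2 + (γ * b ^ 2 + γ ^ 2 * (G + P.εx) ^ 2) := by
    have hdescent := (hy v).inner_gradient_le hP.weaklyConvexOn_jointObjective hu
    rw [← neg_sub v (y v), inner_neg_right, norm_neg, add_sub_cancel_left, one_mul] at hdescent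
    rw [norm_sub_rev]
    nlinarith [hP.expect_step_norm_sub_sq_le hγ hm hb hu (hy v).mem,
      mul_le_mul_of_nonneg_left hdescent hγ, mul_nonneg hγ (sq_nonneg (‖v - y v‖ - b))]
  calc expect (P.step γ m u) (fun w => P.jointObjective (y (WithLp.toLp 2 w)) +
        (L + 1) * ‖y (WithLp.toLp 2 w) - WithLp.toLp 2 w‖ ^ 2)
      ≤ expect (P.step γ m u) fun w =>
          P.jointObjective (y v) + (L + 1) * ‖WithLp.toLp 2 w - y v‖ ^ 2 :=
        expect_mono hfin fun w _ => by
          rw [norm_sub_rev _ (y v)]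
          exact (hy _).le (hy v).mem
    _ = P.jointObjective (y v) +
          (L + 1) * expect (P.step γ m u) fun w => ‖WithLp.toLp 2 w - y v‖ ^ 2 := by
        rw [expect_add hfin, expect_const hfin, expect_const_mul]
    _ ≤ P.jointObjective (y v) + (L + 1) * (‖y v - v‖ ^ 2 - γ * ‖y v - v‖ ^ 2 +
          (γ * b ^ 2 + γ ^ 2 * (G + P.εx) ^ 2)) := by gcongr
    _ = _ := by ring

theorem gradMapSq_le {r : ℝ} (hr : 0 < r) {u : EuclideanSpace ℝ (Fin d) × ℝ}
    (hu : WithLp.toLp 2 u ∈ P.feas) :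
    P.gradMapSq r u ≤ (2 / r + (4 * P.η * G ^ 2 + L) + 2 * (L + 1)) ^ 2 *
      ((L + 1) * ‖y (WithLp.toLp 2 u) - WithLp.toLp 2 u‖ ^ 2) := by
  have hL := hP.L_nonneg
  have hprox := hy (WithLp.toLp 2 u)
  have hnorm := hprox.norm_gradMap_le hP.convex_feas hP.isProjOnto_projFeas (by positivity)
    (hP.hasGradientAt_jointObjective hprox.mem) (hP.norm_gradObjective_sub_le hprox.mem hu) hr
  rw [P.gradMapSq_eq hP.η_pos.ne' (fun ζ => (hP.smooth ζ).1 _ hu.1)]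
  refine (pow_le_pow_left₀ (norm_nonneg _) hnorm 2).trans ?_
  rw [mul_pow]
  gcongr
  exact le_mul_of_one_le_left (sq_nonneg _) (by linarith)

theorem expect_output_norm_sub_sq_le {u₀ : EuclideanSpace ℝ (Fin d) × ℝ}
    (hu₀ : WithLp.toLp 2 u₀ ∈ P.feas) {c : ℝ} (hc : 0 < c) {T : ℕ} [NeZero T] {m : ℕ → ℕ}
    (hm : ∀ t < T, 0 < m t) {b : ℝ} (hb : ∀ t < T, 4 * G * P.𝒳.card / m t ≤ b) :
    expect (P.output T (fun _ => c / √T) m u₀)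
        (fun u => (L + 1) * ‖y (WithLp.toLp 2 u) - WithLp.toLp 2 u‖ ^ 2) ≤
      ((P.jointObjective (WithLp.toLp 2 u₀) - F₀) / c + c * ((L + 1) * (G + P.εx) ^ 2)) / √T
        + (L + 1) * b ^ 2 := by
  have hL := hP.L_nonneg
  have hrate := expect_output_le_of_sqrt_step (S := WithLp.toLp 2 ⁻¹' P.feas) (T := T) (m := m)
    hu₀ hc (fun _ _ _ _ ω => hP.toLp_update_mem _ _ _ ω)
    (fun u _ => (hP.le_jointObjective (hy (WithLp.toLp 2 u)).mem).trans
      (le_add_of_nonneg_right (by positivity)))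
    fun t ht _ hu => hP.expect_step_envelope_le hy (by positivity) (hm t ht) (hb t ht) hu
  have hstart := (hy (WithLp.toLp 2 u₀)).le hu₀
  rw [sub_self, norm_zero, zero_pow two_ne_zero, mul_zero, add_zero] at hstart
  refine hrate.trans ?_
  gcongr

omit hy in
theorem exists_expect_output_gradMapSq_le {r : ℝ} (hr : 0 < r)
    {u₀ : EuclideanSpace ℝ (Fin d) × ℝ} (hu₀ : WithLp.toLp 2 u₀ ∈ P.feas) {c : ℝ} (hc : 0 < c) :
    ∃ K A, 0 ≤ K ∧ 0 ≤ A ∧ ∀ (T : ℕ) [NeZero T] (m : ℕ → ℕ) (b : ℝ), (∀ t < T, 0 < m t) →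
      (∀ t < T, 4 * G * P.𝒳.card / m t ≤ b) →
      expect (P.output T (fun _ => c / √T) m u₀) (P.gradMapSq r) ≤ K / √T + A * b ^ 2 := by
  have hL := hP.L_nonneg
  choose y hy using hP.exists_isProx (κ := L + 1) (by positivity)
  let A := (2 / r + (4 * P.η * G ^ 2 + L) + 2 * (L + 1)) ^ 2
  let K := (P.jointObjective (WithLp.toLp 2 u₀) - F₀) / c + c * ((L + 1) * (G + P.εx) ^ 2)
  have hK : 0 ≤ K :=
    add_nonneg (div_nonneg (sub_nonneg.2 (hP.le_jointObjective hu₀)) hc.le) (by positivity)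
  refine ⟨A * K, A * (L + 1), by positivity, by positivity, fun T _ m b hm hb => ?_⟩
  have hsupp : (P.output T (fun _ => c / √T) m u₀).support ⊆ WithLp.toLp 2 ⁻¹' P.feas :=
    support_output_subset hu₀ fun _ _ _ _ ω => hP.toLp_update_mem _ _ _ ω
  refine (expect_mono (P.finite_support_output _ _ _ _) fun u hu =>
    hP.gradMapSq_le hy hr (hsupp hu)).trans ?_
  rw [expect_const_mul]
  refine (mul_le_mul_of_nonneg_left (hP.expect_output_norm_sub_sq_le hy hu₀ hc hm hb)
    (sq_nonneg _)).trans_eq ?_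
  simp only [A, K]
  ring

end Problem.Regular

section Complexity

theorem totalQueries_ceil_le {a b : ℝ} (ha : 0 ≤ a) (hb : 0 ≤ b) :
    (totalQueries ⌈a⌉₊ (fun _ => ⌈b⌉₊) : ℝ) ≤ (a + 1) * (b + 1) := by
  rw [totalQueries, Finset.sum_const, Finset.card_range, smul_eq_mul, Nat.cast_mul]
  gcongr
  · exact (Nat.ceil_lt_add_one ha).le
  · exact (Nat.ceil_lt_add_one hb).le

theorem add_one_le_div_pow {A δ δ₀ : ℝ} (hδ : 0 < δ) (hδδ₀ : δ ≤ δ₀) (n : ℕ) :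
    A / δ ^ n + 1 ≤ (A + δ₀ ^ n) / δ ^ n := by
  rw [add_div]
  gcongr
  exact (one_le_div (by positivity)).2 (by gcongr)

theorem totalQueries_ceil_le_div_pow {A D δ δ₀ : ℝ} (hA : 0 ≤ A) (hD : 0 ≤ D) (hδ : 0 < δ)
    (hδδ₀ : δ ≤ δ₀) (i j : ℕ) :
    (totalQueries ⌈A / δ ^ i⌉₊ (fun _ => ⌈D / δ ^ j⌉₊) : ℝ) ≤
      (A + δ₀ ^ i) * (D + δ₀ ^ j) / δ ^ (i + j) := by
  have hδ₀ := hδ.trans_le hδδ₀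
  rw [pow_add, ← div_mul_div_comm]
  refine (totalQueries_ceil_le (by positivity) (by positivity)).trans ?_
  gcongr <;> exact add_one_le_div_pow hδ hδδ₀ _

theorem div_sqrt_le_half {K e : ℝ} (hK : 0 ≤ K) (he : 0 < e) {T : ℝ}
    (hT : (2 * K + 1) ^ 2 / e ^ 2 ≤ T) : K / √T ≤ e / 2 := by
  have hsqrt : (2 * K + 1) / e ≤ √T := Real.le_sqrt_of_sq_le (by rwa [div_pow])
  have hpos : 0 < (2 * K + 1) / e := by positivity
  rw [div_le_div_iff₀ (hpos.trans_le hsqrt) two_pos]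
  rw [div_le_iff₀ he] at hsqrt
  linarith

theorem pos_and_div_le_of_div_le {C D e : ℝ} (hC : 0 ≤ C) (hD : 0 < D) (he : 0 < e) {m : ℕ}
    (hm : D / e ≤ m) : 0 < m ∧ C / m ≤ C * e / D := by
  have hm0 : (0 : ℝ) < m := (div_pos hD he).trans_le hm
  refine ⟨Nat.cast_pos.1 hm0, ?_⟩
  rw [mul_div_assoc, div_eq_mul_inv, ← inv_div D e]
  gcongr

theorem exists_batch_const_of_linear {C E ε δ₀ : ℝ} (hC : 0 ≤ C) (hE : 0 ≤ E) (hε : 0 < ε)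
    (hδ₀ : 0 < δ₀) :
    ∃ Cm, 0 < Cm ∧ ∀ δ, 0 < δ → δ ≤ δ₀ → ∃ b, 2 * b ≤ ε ∧ 2 * b * E ≤ δ / 2 ∧
      ∀ m : ℕ, Cm / δ ≤ m → 0 < m ∧ C / m ≤ b := by
  let Cm := 4 * C * E + 2 * C * δ₀ / ε + 1
  have hCm : 0 < Cm := by positivity
  have hradius : 2 * C * δ₀ ≤ ε * Cm := by
    have hexpand : ε * Cm = ε * (4 * C * E + 1) + 2 * C * δ₀ := by
      simp only [Cm]
      field_simp
      ring
    linarith [mul_nonneg hε.le (by positivity : 0 ≤ 4 * C * E + 1)]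
  have hbias : 4 * C * E ≤ Cm := by
    have hrest : 0 ≤ 2 * C * δ₀ / ε := by positivity
    simp only [Cm]
    linarith
  refine ⟨Cm, hCm, fun δ hδ hδδ₀ => ⟨C * δ / Cm, ?_, ?_, fun m hm =>
    pos_and_div_le_of_div_le hC hCm hδ hm⟩⟩
  · rw [← mul_div_assoc, div_le_iff₀ hCm, ← mul_assoc]
    exact (by gcongr : 2 * C * δ ≤ 2 * C * δ₀).trans hradius
  · rw [← mul_div_assoc, div_mul_eq_mul_div, div_le_iff₀ hCm]
    linarith [mul_le_mul_of_nonneg_left hbias hδ.le]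

theorem exists_batch_const_of_quadratic {C A δ₀ : ℝ} (hC : 0 ≤ C) (hA : 0 ≤ A) :
    ∃ Cm, 0 < Cm ∧ ∀ δ, 0 < δ → δ ≤ δ₀ → ∃ b, A * b ^ 2 ≤ δ ^ 2 / 2 ∧
      ∀ m : ℕ, Cm / δ ^ 2 ≤ m → 0 < m ∧ C / m ≤ b := by
  let Cm := 2 * A * C ^ 2 * δ₀ ^ 2 + 1
  have hCm : 1 ≤ Cm := le_add_of_nonneg_left (by positivity)
  have hCm0 : 0 < Cm := one_pos.trans_le hCm
  refine ⟨Cm, hCm0, fun δ hδ hδδ₀ => ⟨C * δ ^ 2 / Cm, ?_, fun m hm =>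
    pos_and_div_le_of_div_le hC hCm0 (by positivity) hm⟩⟩
  have hbias : 2 * A * C ^ 2 * δ ^ 2 ≤ Cm ^ 2 := by
    calc 2 * A * C ^ 2 * δ ^ 2 ≤ 2 * A * C ^ 2 * δ₀ ^ 2 := by gcongr
      _ ≤ Cm := (lt_add_one _).le
      _ ≤ Cm ^ 2 := le_self_pow₀ hCm two_ne_zero
  rw [div_pow, ← mul_div_assoc, div_le_iff₀ (by positivity)]
  linarith [mul_le_mul_of_nonneg_left hbias (sq_nonneg δ)]

end Complexity

namespace Problem.Regular

variable {d q k : ℕ} {P : Problem d q k} {L G F₀ : ℝ} (hP : P.Regular L G F₀)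
  {u₀ : EuclideanSpace ℝ (Fin d) × ℝ} (hu₀ : WithLp.toLp 2 u₀ ∈ P.feas)
  {c δ₀ : ℝ} (hc : 0 < c) (hδ₀ : 0 < δ₀)
include hP hu₀ hc hδ₀

theorem exists_complexity_of_convexOn (hconv : ∀ ζ, ConvexOn ℝ P.Θ fun θ => P.lhat θ ζ) :
    ∃ Cm CT CQ : ℝ, 0 < Cm ∧ 0 < CT ∧ 0 < CQ ∧ ∀ δ : ℝ, 0 < δ → δ ≤ δ₀ →
      (∀ (T : ℕ) [NeZero T] (m : ℕ → ℕ), CT / δ ^ 2 ≤ T → (∀ t < T, Cm / δ ≤ m t) →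
        ∀ u ∈ P.feas, expect (P.output T (fun _ => c / √T) m u₀)
          (fun u => P.objective u.1 u.2) - P.jointObjective u ≤ δ) ∧
      (totalQueries ⌈CT / δ ^ 2⌉₊ (fun _ => ⌈Cm / δ⌉₊) : ℝ) ≤ CQ / δ ^ 3 := by
  have hG := hP.G_nonneg
  obtain ⟨K, E, hK, hE, hrate⟩ := hP.exists_expect_output_objective_sub_le hconv hu₀ hc
  obtain ⟨Cm, hCm, hbatch⟩ := exists_batch_const_of_linear (C := 4 * G * P.𝒳.card) (by positivity)
    hE hP.εx_pos hδ₀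
  refine ⟨Cm, (2 * K + 1) ^ 2, ((2 * K + 1) ^ 2 + δ₀ ^ 2) * (Cm + δ₀ ^ 1), hCm, by positivity,
    by positivity, fun δ hδ hδδ₀ => ⟨fun T _ m hT hm u hu => ?_, ?_⟩⟩
  · obtain ⟨b, hbε, hbE, hbm⟩ := hbatch δ hδ hδδ₀
    linarith [div_sqrt_le_half hK hδ hT, hrate T m b (fun t ht => (hbm _ (hm t ht)).1)
      (fun t ht => (hbm _ (hm t ht)).2) hbε u hu]
  · simpa only [pow_one] using
      totalQueries_ceil_le_div_pow (sq_nonneg (2 * K + 1)) hCm.le hδ hδδ₀ 2 1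

theorem exists_complexity {r : ℝ} (hr : 0 < r) :
    ∃ Cm CT CQ : ℝ, 0 < Cm ∧ 0 < CT ∧ 0 < CQ ∧ ∀ δ : ℝ, 0 < δ → δ ≤ δ₀ →
      (∀ (T : ℕ) [NeZero T] (m : ℕ → ℕ), CT / δ ^ 4 ≤ T → (∀ t < T, Cm / δ ^ 2 ≤ m t) →
        expect (P.output T (fun _ => c / √T) m u₀) (P.gradMapSq r) ≤ δ ^ 2) ∧
      (totalQueries ⌈CT / δ ^ 4⌉₊ (fun _ => ⌈Cm / δ ^ 2⌉₊) : ℝ) ≤ CQ / δ ^ 6 := by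
  have hG := hP.G_nonneg
  obtain ⟨K, A, hK, hA, hrate⟩ := hP.exists_expect_output_gradMapSq_le hr hu₀ hc
  obtain ⟨Cm, hCm, hbatch⟩ := exists_batch_const_of_quadratic (C := 4 * G * P.𝒳.card) (δ₀ := δ₀)
    (by positivity) hA
  refine ⟨Cm, (2 * K + 1) ^ 2, ((2 * K + 1) ^ 2 + δ₀ ^ 4) * (Cm + δ₀ ^ 2), hCm, by positivity,
    by positivity, fun δ hδ hδδ₀ => ⟨fun T _ m hT hm => ?_,
    totalQueries_ceil_le_div_pow (sq_nonneg _) hCm.le hδ hδδ₀ 4 2⟩⟩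
  obtain ⟨b, hbA, hbm⟩ := hbatch δ hδ hδδ₀
  have hsqrt : K / √T ≤ δ ^ 2 / 2 := div_sqrt_le_half hK (by positivity) (by rwa [← pow_mul])
  linarith [hrate T m b (fun t ht => (hbm _ (hm t ht)).1) fun t ht => (hbm _ (hm t ht)).2]

end Problem.Regular

end WassersteinOPL

end

theorem mainTheorem4 {d q k : ℕ} (P : WassersteinOPL.Problem d q k)
    (hη : 0 < P.η) (hε : 0 < P.εx)
    (hcompact : IsCompact P.Θ) (hconvex : Convex ℝ P.Θ)
    (hpol : ∀ θ ∈ P.Θ, ∀ ζ, P.pol θ ζ ∈ stdSimplex ℝ (Fin k))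
    (B : ℝ) (hB : 0 < B) (hdiam : ∀ x ∈ P.𝒳, ∀ y ∈ P.𝒳, ‖x - y‖ ≤ B)
    (L : ℝ) (hsmooth : ∀ ζ, WassersteinOPL.SmoothOn L (fun θ => P.lhat θ ζ) P.Θ)
    (θ₀ : EuclideanSpace ℝ (Fin d)) (hθ₀ : θ₀ ∈ P.Θ) (lam₀ : ℝ) (hlam₀ : 0 ≤ lam₀)
    (c : ℝ) (hc : 0 < c) (δ₀ : ℝ) (hδ₀ : 0 < δ₀) :
    ((∀ ζ, ConvexOn ℝ P.Θ (fun θ => P.lhat θ ζ)) →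
      ∃ Cm CT CQ : ℝ, 0 < Cm ∧ 0 < CT ∧ 0 < CQ ∧ ∀ δ : ℝ, 0 < δ → δ ≤ δ₀ →
        (∀ (T : ℕ) [NeZero T] (m : ℕ → ℕ),
          CT / δ ^ 2 ≤ T → (∀ t < T, Cm / δ ≤ m t) →
          ∀ θ ∈ P.Θ, ∀ lam : ℝ, 0 ≤ lam →
            WassersteinOPL.expect (P.output T (fun _ => c / Real.sqrt T) m (θ₀, lam₀))
              (fun u => P.objective u.1 u.2) - P.objective θ lam ≤ δ) ∧
        (WassersteinOPL.totalQueries ⌈CT / δ ^ 2⌉₊ (fun _ => ⌈Cm / δ⌉₊) : ℝ) ≤ CQ / δ ^ 3) ∧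
    (∀ r : ℝ, 0 < r →
      ∃ Cm CT CQ : ℝ, 0 < Cm ∧ 0 < CT ∧ 0 < CQ ∧ ∀ δ : ℝ, 0 < δ → δ ≤ δ₀ →
        (∀ (T : ℕ) [NeZero T] (m : ℕ → ℕ),
          CT / δ ^ 4 ≤ T → (∀ t < T, Cm / δ ^ 2 ≤ m t) →
            WassersteinOPL.expect (P.output T (fun _ => c / Real.sqrt T) m (θ₀, lam₀))
              (P.gradMapSq r) ≤ δ ^ 2) ∧
        (WassersteinOPL.totalQueries ⌈CT / δ ^ 4⌉₊ (fun _ => ⌈Cm / δ ^ 2⌉₊) : ℝ) ≤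
          CQ / δ ^ 6) := by
  obtain ⟨L', G, F₀, hP⟩ := WassersteinOPL.Problem.exists_regular hη hε hcompact hconvex
    ⟨θ₀, hθ₀⟩ hpol hdiam hsmooth
  have hu₀ : WithLp.toLp 2 (θ₀, lam₀) ∈ P.feas := ⟨hθ₀, hlam₀⟩
  refine ⟨fun hconv => ?_, fun r hr => hP.exists_complexity hu₀ hc hδ₀ hr⟩
  obtain ⟨Cm, CT, CQ, hCm, hCT, hCQ, hcomplexity⟩ :=
    hP.exists_complexity_of_convexOn hu₀ hc hδ₀ hconv
  exact ⟨Cm, CT, CQ, hCm, hCT, hCQ, fun δ hδ hδδ₀ =>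
    ⟨fun T _ m hT hm θ hθ lam hlam => (hcomplexity δ hδ hδδ₀).1 T m hT hm (WithLp.toLp 2 (θ, lam))
      ⟨hθ, hlam⟩, (hcomplexity δ hδ hδδ₀).2⟩⟩
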